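/- Conventions. A knot diagram $D$ is an oriented knot diagram on the sphere $S^2=\mathbb R^2\cup\{\infty\}$ with a starting point $b$, given by a polygonal knot in $\mathbb R^3$ in general position with respect to the projection to $\mathbb R^2$ (finitely many multiple points, all of them double points, none at a corner or at $b$). Its Gauss code is the word obtained by following $D$ from $b$ and writing $x^{+1}$ (resp. $x^{-1}$) whenever the crossing $x$ is traversed over (resp. under). $D$ is ascending (resp. descending) if, from $b$ on, every crossing is first met as an undercrossing (resp. overcrossing). A detour move on an arc $\gamma$ of $D$ that meets only undercrossings (resp. only overcrossings) is an ambient isotopy of $\mathbb R^3$ which fixes the rest of the knot pointwise, keeps $\gamma$ beneath (resp. above) the rest of the diagram throughout, and ends at a diagram in which $\gamma$ meets no crossings or only undercrossings (resp. only overcrossings). It is an $(m,n)$-tangle detour move if the old and the new position of $\gamma$ together form a simple closed curve in the projection (so that they bound a disc, which contains a tangle) and $\gamma$ meets exactly $m$ crossings before and exactly $n$ crossings after the move. Let $\gamma^\dagger$ be an arc with exactly one self-crossing $u$, all of whose other crossings lie on the loop from $u$ to $u$ and are met by $\gamma^\dagger$ only as undercrossings (or only as overcrossings), and whose two end edges at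 $u$ lie on the same side of the loop, i.e. outside the disc on $S^2$ bounded by the loop. If $\gamma$ is the part of the loop that contains its $m$ crossings other than $u$, a loop detour move is an $(m,0)$-tangle detour move of $\gamma$ followed by a Type I Reidemeister move that removes $u$. Theorem. Let $D$ be an ascending or descending knot diagram; put $\varepsilon=-1$ if $D$ is ascending and $\varepsilon=+1$ if $D$ is descending. Then there is a finite sequence of knot diagrams $D=D_0,D_1,\dots,D_N$ such that $D_N$ has no crossings (so its Gauss code is empty) and, for every $i<N$, $D_{i+1}$ arises from $D_i$ by a loop detour move on a loop all of whose crossings other than its self-crossing $u$ are undercrossings (if $\varepsilon=-1$), resp. overcrossings (if $\varepsilon=+1$), of the loop. On Gauss codes, when the crossings of $D_i$ are numbered in the order in which they are first met, this move deletes a block of the form $$u^{\varepsilon}(u+1)^{\varepsilon}\cdots v^{\varepsilon}u^{-\varepsilon},\qquad v\ge u,$$ together with the other occurrences of $u+1,\dots,v$, and changes nothing else except for renumbering; in particular $D_{i+1}$ has strictly fewer crossings than $D_i$. Consequently, $D$ represents the unknot: an ambient isotopy of $\mathbb R^3$ carries the knot to a round circle. -/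

import Mathlib

open Set Topology

noncomputable section

/-- Three-space, seen as a plane times the height axis; diagrams are drawn by forgetting the
height. -/
abbrev Space : Type := ℂ × ℝ

/-- `k` is affine, as a function of the parameter, in a neighbourhood of `t`. -/
def AffineAt (k : ℝ → Space) (t : ℝ) : Prop :=
  ∃ v : Space, ∀ᶠ s in 𝓝 t, k s = k t + (s - t) • v

/-- The parameters in `[0, 1)` of a closed curve at which its planar projection passes through a
multiple point. -/
def crossingTimesOf (k : ℝ → Space) : Set ℝ :=
  {t | t ∈ Ico (0 : ℝ) 1 ∧ ∃ s ∈ Ico (0 : ℝ) 1, s ≠ t ∧ (k s).1 = (k t).1}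

/-- An oriented knot diagram with a starting point: a polygonal knot `[0, 1] → Space`, with
`0` and `1` glued, in general position with respect to the projection to the plane.  The
diagram is the projection with the over/under information given by the heights, the orientation
is the direction of increasing parameter, and the starting point is at parameter `0`.  Values
of `toFun` outside `[0, 1]` are never used.

The plane is regarded as the sphere minus a point. -/
structure KnotDiagram where
  toFun : ℝ → Space
  closed : toFun 0 = toFun 1
  continuousOn : ContinuousOn toFun (Icc 0 1)
  /-- The curve is polygonal: only finitely many corners. -/
  polygonal : {t | t ∈ Ioo (0 : ℝ) 1 ∧ ¬ AffineAt toFun t}.Finite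
  /-- The curve has no self-intersections in space. -/
  injOn : InjOn toFun (Ico 0 1)
  /-- There are only finitely many multiple points in the projection (so edges cross
  transversally and no edge is vertical). -/
  finite_crossings : (crossingTimesOf toFun).Finite
  /-- All multiple points are double points. -/
  no_triple : ∀ r ∈ Ico (0 : ℝ) 1, ∀ s ∈ Ico (0 : ℝ) 1, ∀ t ∈ Ico (0 : ℝ) 1,
    r ≠ s → r ≠ t → s ≠ t → ¬ ((toFun r).1 = (toFun s).1 ∧ (toFun s).1 = (toFun t).1)
  /-- Crossings are neither at the starting point nor at a corner. -/
  crossing_interior : ∀ t ∈ crossingTimesOf toFun, t ≠ 0 ∧ AffineAt toFun t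

/-- `x` lies above `y` (for `ε = 1`), respectively below `y` (for `ε = -1`). -/
def OnSide (ε : ℤˣ) (x y : Space) : Prop :=
  (ε = 1 → y.2 < x.2) ∧ (ε = -1 → x.2 < y.2)

/-- An ambient isotopy of three-space, starting at the identity. -/
def IsAmbientIsotopy (H : unitInterval → (Space ≃ₜ Space)) : Prop :=
  (Continuous fun x : unitInterval × Space => H x.1 x.2) ∧ H 0 = Homeomorph.refl Space

/-- A subset of three-space is an unknot if an ambient isotopy carries it to the round circle. -/
def IsUnknot (K : Set Space) : Prop :=
  ∃ H : unitInterval → (Space ≃ₜ Space), IsAmbientIsotopy H ∧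
    H 1 '' K = {x : Space | ‖x.1‖ = 1 ∧ x.2 = 0}

namespace KnotDiagram

/-- The planar projection of the knot. -/
def proj (D : KnotDiagram) (t : ℝ) : ℂ := (D.toFun t).1

/-- The knot in three-space represented by the diagram. -/
def knot (D : KnotDiagram) : Set Space := D.toFun '' Icc 0 1

/-- The parameters at which the diagram runs through a crossing; every crossing has two. -/
def crossingTimes (D : KnotDiagram) : Set ℝ := crossingTimesOf D.toFun

/-- The crossings, as points of the plane. -/
def crossings (D : KnotDiagram) : Set ℂ := D.proj '' D.crossingTimes

/-- The number of crossings. -/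
def crossingNumber (D : KnotDiagram) : ℕ := D.crossings.ncard

/-- From the starting point on, every crossing is met first as an undercrossing, then as an
overcrossing. -/
def IsAscending (D : KnotDiagram) : Prop :=
  ∀ s ∈ Ico (0 : ℝ) 1, ∀ t ∈ Ico (0 : ℝ) 1, s < t → D.proj s = D.proj t →
    (D.toFun s).2 < (D.toFun t).2

/-- From the starting point on, every crossing is met first as an overcrossing, then as an
undercrossing. -/
def IsDescending (D : KnotDiagram) : Prop :=
  ∀ s ∈ Ico (0 : ℝ) 1, ∀ t ∈ Ico (0 : ℝ) 1, s < t → D.proj s = D.proj t →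
    (D.toFun t).2 < (D.toFun s).2

open Classical in
/-- The sign of the crossing met at time `t`: `+1` if it is traversed over, `-1` if under. -/
def signAt (D : KnotDiagram) (t : ℝ) : ℤˣ :=
  if ∃ s ∈ Ico (0 : ℝ) 1, s ≠ t ∧ D.proj s = D.proj t ∧ (D.toFun s).2 < (D.toFun t).2
  then 1 else -1

/-- The Gauss code from the starting point: the crossings in the order in which they are met,
each with its sign.  As the label of a crossing we use the crossing itself. -/
def gaussCode (D : KnotDiagram) : List (ℂ × ℤˣ) :=
  (D.finite_crossings.toFinset.sort (· ≤ ·)).map fun t => (D.proj t, D.signAt t)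

/-- On the open parameter interval `(a, b)` the diagram meets only overcrossings (`ε = 1`),
respectively only undercrossings (`ε = -1`).  In particular that arc does not cross itself. -/
def MeetsOnly (D : KnotDiagram) (ε : ℤˣ) (a b : ℝ) : Prop :=
  ∀ t ∈ Ioo a b, ∀ s ∈ Ico (0 : ℝ) 1, s ≠ t → D.proj s = D.proj t →
    OnSide ε (D.toFun t) (D.toFun s)

/-- A detour move along the arc `γ` with parameters `[a, b]`: an ambient isotopy from the knot of
`D` to the knot of `E` that moves only `γ`, beneath (`ε = -1`) or above (`ε = 1`) the rest of the
diagram, where `γ` meets only undercrossings (respectively overcrossings) before and after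
the move.  (The arc does not contain the starting point.) -/
structure IsDetour (ε : ℤˣ) (a b : ℝ) (D E : KnotDiagram) : Prop where
  zero_lt : 0 < a
  lt : a < b
  lt_one : b < 1
  before : D.MeetsOnly ε a b
  after : E.MeetsOnly ε a b
  isotopy : ∃ H : unitInterval → (Space ≃ₜ Space), IsAmbientIsotopy H ∧
    (∀ t ∈ Icc (0 : ℝ) 1, H 1 (D.toFun t) = E.toFun t) ∧
    (∀ τ, ∀ t ∈ Icc (0 : ℝ) 1 \ Ioo a b, H τ (D.toFun t) = D.toFun t) ∧
    (∀ τ, ∀ t ∈ Ioo a b, ∀ s ∈ Icc (0 : ℝ) 1 \ Ioo a b,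
      (H τ (D.toFun t)).1 = D.proj s → OnSide ε (H τ (D.toFun t)) (D.toFun s))

/-- An `(m, n)`-tangle detour move: the endpoints of the detour arc are not crossings, the old and the
new position of the detour arc together form a simple closed curve in the projection, hence bound a disc on the sphere, and the arc meets
`m` crossings before and `n` crossings after the move (all of them with the tangle formed by the
part of the diagram in that disc). -/
structure IsTangleDetour (ε : ℤˣ) (m n : ℕ) (a b : ℝ) (D E : KnotDiagram) : Prop where
  detour : IsDetour ε a b D E
  ends : a ∉ D.crossingTimes ∧ b ∉ D.crossingTimes ∧ a ∉ E.crossingTimes ∧ b ∉ E.crossingTimes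
  disjoint : ∀ t ∈ Ioo a b, ∀ t' ∈ Ioo a b, D.proj t ≠ E.proj t'
  card_before : (D.crossingTimes ∩ Ioo a b).ncard = m
  card_after : (E.crossingTimes ∩ Ioo a b).ncard = n

/-- The arc `γ†` with parameters `[p, q]` is a loop with one self-crossing, met at the times
`s < t`, and two end edges `[p, s)`, `(t, q]` free of crossings; all its other crossings are
overcrossings (`ε = 1`), respectively undercrossings (`ε = -1`), of `γ†`; and the two end
edges lie in the same complementary region of the loop, that is, in the exterior of the disc
which the loop bounds on the other side on the sphere. -/
structure IsLoop (ε : ℤˣ) (p s t q : ℝ) (D : KnotDiagram) : Prop where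
  zero_lt : 0 < p
  lt_left : p < s
  lt : s < t
  lt_right : t < q
  lt_one : q < 1
  crossing : D.proj s = D.proj t
  only_self_crossing : ∀ x ∈ Icc p q, ∀ y ∈ Icc p q, x < y → D.proj x = D.proj y →
    x = s ∧ y = t
  free_ends : ∀ x ∈ D.crossingTimes ∩ Icc p q, x ∈ Icc s t
  meetsOnly : D.MeetsOnly ε s t
  exterior : JoinedIn (D.proj '' Icc s t)ᶜ (D.proj p) (D.proj q)

/-- A Type I Reidemeister move removing the crossing met at the times `s < t`: inside a
closed disc of the plane, an arc `[p, q]` whose only crossing is this self-crossing is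
replaced by an arc without crossings; outside nothing changes. -/
def IsReidemeisterI (s t : ℝ) (D E : KnotDiagram) : Prop :=
  ∃ p q : ℝ, 0 < p ∧ p < s ∧ s < t ∧ t < q ∧ q < 1 ∧
    D.proj s = D.proj t ∧
    D.crossingTimes ∩ Icc p q = {s, t} ∧
    E.crossingTimes ∩ Icc p q = ∅ ∧
    (∀ x ∈ Icc (0 : ℝ) 1 \ Ioo p q, E.toFun x = D.toFun x) ∧
    ∃ h : ℂ ≃ₜ ℂ,
      (∀ x ∈ Icc p q, D.proj x ∈ h '' Metric.closedBall 0 1 ∧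
        E.proj x ∈ h '' Metric.closedBall 0 1) ∧
      (∀ x ∈ Icc (0 : ℝ) 1 \ Ioo p q, D.proj x ∉ h '' Metric.ball 0 1)

/-- A loop detour move at the crossing met at the times `s < t`: there is a loop `γ†` based at this
crossing, a tangle detour move takes the subarc `γ` of the loop that contains all its other
crossings, say `m` of them, off everything it meets, and then a Type I Reidemeister move
removes the crossing. -/
def IsLoopDetour (ε : ℤˣ) (s t : ℝ) (D D' : KnotDiagram) : Prop :=
  ∃ (p q a b : ℝ) (E : KnotDiagram), IsLoop ε p s t q D ∧ s < a ∧ b < t ∧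
    D.crossingTimes ∩ Ioo s t ⊆ Ioo a b ∧
    IsTangleDetour ε (D.crossingTimes ∩ Ioo s t).ncard 0 a b D E ∧
    IsReidemeisterI s t E D'

end KnotDiagram

open Classical in
/-- `w'` arises from the Gauss code `w` by deleting a block
`u^ε x₁^ε ⋯ x_r^ε u^(-ε)`, in which `u, x₁, …, x_r` are distinct crossings that do not
occur before the block (so in the numbering of the crossings by first occurrence they are
consecutive: `u, u+1, …, v`), together with all other occurrences of `x₁, …, x_r`. -/
def DeletesBlock (ε : ℤˣ) (u : ℂ) (w w' : List (ℂ × ℤˣ)) : Prop :=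
  ∃ (A B : List (ℂ × ℤˣ)) (xs : List ℂ),
    w = A ++ ((u, ε) :: xs.map fun x => (x, ε)) ++ ((u, -ε) :: B) ∧
    (u :: xs).Nodup ∧ (∀ l ∈ A, l.1 ∉ u :: xs) ∧
    w' = (A ++ B).filter fun l => l.1 ∉ xs

end

/-! ### Building ambient isotopies -/

/-! Follow the diagram from the starting point up to the first time `t` at which it returns to a
point of the plane already visited, say at time `s` (`exists_first_closing`). Before `t` the
projection is injective, so every crossing met there is met for the first time. In an ascending
diagram all these passages are therefore under, in a descending one over
(`meetsOnly_of_first_closing`). The part between `s` and `t` is thus a simple loop that passes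
everything else on one side.

Choose a round disc about the crossing that the diagram meets only in two transversal straight
diameters (`exists_isCrossingDisc`). A chord from one diameter to the other, ending off the centre,
lies in the disc and touches the diameters only at its ends, so replacing an arc by such a chord
creates no crossings (`IsCrossingDisc.isReplaceable`). The chord between the inner ends of the
diameters gives the tangle detour, the chord between the outer ends gives the diagram after the
Reidemeister move. The result is again ascending or descending and has fewer crossings, and its
Gauss code is obtained by restricting the old one to the surviving passages
(`mem_crossingTimes_outer`, `deletesBlock`). Induction on the number of crossings yields the
sequence.

The topological core is `arcIsotopic_of_isPassingArc`: two arcs with simple projections and common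
ends that pass a compact set `R` on the same side are isotopic relative to `R`. A vertical shear
puts `R` at heights at least 0 and the ends at height 0. Vertical pushes then give both arcs the
same V-shaped height profile below 0. Each level now meets an arc in at most two points, so a
similarity of each horizontal plane carries one arc to the other. The similarities vary
continuously, also at the bottom of the V because the projections have nonzero derivative there, and
a continuous logarithm of their factors connects them to the identity.

A diagram without crossings is treated by the same lemma: twice an arc is exchanged for half of an
ellipse, and the ellipse is carried to the round circle by an explicit isotopy
(`isUnknot_of_crossingTimes_eq_empty`). -/

theorem exists_isAmbientIsotopy_of_inverse (F G : unitInterval × Space → Space)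
    (hF : Continuous F) (hG : Continuous G) (hGF : ∀ τ x, G (τ, F (τ, x)) = x)
    (hFG : ∀ τ x, F (τ, G (τ, x)) = x) (h0 : ∀ x, F (0, x) = x) :
    ∃ H : unitInterval → (Space ≃ₜ Space), IsAmbientIsotopy H ∧ ∀ τ x, H τ x = F (τ, x) := by
  refine ⟨fun τ =>
    { toFun := fun x => F (τ, x)
      invFun := fun x => G (τ, x)
      left_inv := hGF τ
      right_inv := hFG τ
      continuous_toFun := by fun_prop
      continuous_invFun := by fun_prop }, ⟨hF, ?_⟩, fun _ _ => rfl⟩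
  ext1 x
  exact h0 x

/-- `H` runs at double speed, then `G`. The last clause says that every intermediate stage is a
stage of one of the two, so conditions imposed on all stages survive concatenation. -/
theorem IsAmbientIsotopy.exists_concat {H G : unitInterval → (Space ≃ₜ Space)}
    (hH : IsAmbientIsotopy H) (hG : IsAmbientIsotopy G) :
    ∃ K : unitInterval → (Space ≃ₜ Space), IsAmbientIsotopy K ∧
      (∀ x, K 1 x = G 1 (H 1 x)) ∧
      ∀ τ, (∃ σ, ∀ x, K τ x = H σ x) ∨ (∃ σ, ∀ x, K τ x = G σ (H 1 x)) := by
  set φ : unitInterval → unitInterval := fun τ => Set.projIcc 0 1 zero_le_one (2 * (τ : ℝ))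
  set ψ : unitInterval → unitInterval := fun τ => Set.projIcc 0 1 zero_le_one (2 * (τ : ℝ) - 1)
  have hφ : Continuous φ := continuous_projIcc.comp (by fun_prop)
  have hψ : Continuous ψ := continuous_projIcc.comp (by fun_prop)
  have hφ0 : φ 0 = 0 := Set.projIcc_of_le_left _ (by simp)
  have hψ0 : ψ 0 = 0 := Set.projIcc_of_le_left _ (by simp)
  have hφ1 : φ 1 = 1 := Set.projIcc_of_right_le _ (by norm_num)
  have hψ1 : ψ 1 = 1 := Set.projIcc_of_right_le _ (by norm_num)
  refine ⟨fun τ => (H (φ τ)).trans (G (ψ τ)), ⟨?_, ?_⟩, ?_, ?_⟩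
  · have h1 : Continuous fun x : unitInterval × Space => H (φ x.1) x.2 :=
      hH.1.comp (f := fun x : unitInterval × Space => (φ x.1, x.2)) (by fun_prop)
    exact hG.1.comp (f := fun x : unitInterval × Space => (ψ x.1, H (φ x.1) x.2))
      ((hψ.comp continuous_fst).prodMk h1)
  · ext1 x
    simp [hφ0, hψ0, hH.2, hG.2]
  · intro x
    simp [hφ1, hψ1]
  · intro τ
    rcases le_total (2 * (τ : ℝ)) 1 with h | h
    · left
      have : ψ τ = 0 := Set.projIcc_of_le_left _ (by linarith)
      exact ⟨φ τ, fun x => by simp [this, hG.2]⟩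
    · right
      have : φ τ = 1 := Set.projIcc_of_right_le _ h
      exact ⟨ψ τ, fun x => by simp [this]⟩

theorem IsAmbientIsotopy.exists_reverse {H : unitInterval → (Space ≃ₜ Space)}
    (hH : IsAmbientIsotopy H) :
    ∃ K : unitInterval → (Space ≃ₜ Space), IsAmbientIsotopy K ∧
      (∀ x, K 1 (H 1 x) = x) ∧ ∀ τ, ∃ σ, ∀ x, K τ (H 1 x) = H σ x := by
  refine ⟨fun τ => (H 1).symm.trans (H (unitInterval.symm τ)), ⟨?_, ?_⟩, ?_, ?_⟩
  · exact hH.1.comp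
      (f := fun x : unitInterval × Space => (unitInterval.symm x.1, (H 1).symm x.2)) (by fun_prop)
  · ext1 x
    simp
  · intro x
    simp [hH.2]
  · intro τ
    exact ⟨unitInterval.symm τ, fun x => by simp⟩

theorem IsAmbientIsotopy.exists_conj {H : unitInterval → (Space ≃ₜ Space)}
    (hH : IsAmbientIsotopy H) (Ψ : Space ≃ₜ Space) :
    ∃ K : unitInterval → (Space ≃ₜ Space), IsAmbientIsotopy K ∧
      ∀ τ x, K τ x = Ψ.symm (H τ (Ψ x)) := by
  refine ⟨fun τ => (Ψ.trans (H τ)).trans Ψ.symm, ⟨?_, ?_⟩, fun _ _ => rfl⟩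
  · exact Ψ.symm.continuous.comp
      (hH.1.comp (f := fun x : unitInterval × Space => (x.1, Ψ x.2)) (by fun_prop))
  · ext1 x
    simp [hH.2]

/-- Two subsets of three-space are ambient isotopic. -/
def AmbientIsotopic (K L : Set Space) : Prop :=
  ∃ H : unitInterval → (Space ≃ₜ Space), IsAmbientIsotopy H ∧ H 1 '' K = L

theorem AmbientIsotopic.trans {K L M : Set Space} (h₁ : AmbientIsotopic K L)
    (h₂ : AmbientIsotopic L M) : AmbientIsotopic K M := by
  obtain ⟨H, hH, rfl⟩ := h₁
  obtain ⟨G, hG, rfl⟩ := h₂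
  obtain ⟨J, hJ, hJ1, -⟩ := hH.exists_concat hG
  refine ⟨J, hJ, ?_⟩
  rw [image_image]
  exact image_congr fun x _ => hJ1 x

theorem AmbientIsotopic.isUnknot {K L : Set Space} (h : AmbientIsotopic K L) (hL : IsUnknot L) :
    IsUnknot K :=
  AmbientIsotopic.trans h hL

/-! ### Isotopies of an arc relative to a set which it passes on one side -/

/-- The arcs `c` and `e` with parameters in `[a, b]` are isotopic in three-space by an ambient
isotopy that fixes `R` and keeps the interior of the arc above (`ε = 1`) or below (`ε = -1`) `R`. -/
def ArcIsotopic (ε : ℤˣ) (R : Set Space) (a b : ℝ) (c e : ℝ → Space) : Prop :=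
  ∃ H : unitInterval → (Space ≃ₜ Space), IsAmbientIsotopy H ∧
    (∀ t ∈ Icc a b, H 1 (c t) = e t) ∧ (∀ τ, ∀ r ∈ R, H τ r = r) ∧
    ∀ τ, ∀ t ∈ Ioo a b, ∀ r ∈ R, (H τ (c t)).1 = r.1 → OnSide ε (H τ (c t)) r

theorem ArcIsotopic.trans {ε : ℤˣ} {R : Set Space} {a b : ℝ} {c d e : ℝ → Space}
    (h₁ : ArcIsotopic ε R a b c d) (h₂ : ArcIsotopic ε R a b d e) : ArcIsotopic ε R a b c e := by
  obtain ⟨H, hH, hcd, hR, hs⟩ := h₁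
  obtain ⟨G, hG, hde, hR', hs'⟩ := h₂
  obtain ⟨K, hK, hK1, hKτ⟩ := hH.exists_concat hG
  refine ⟨K, hK, fun t ht => by rw [hK1, hcd t ht, hde t ht], fun τ r hr => ?_,
    fun τ t ht r hr => ?_⟩
  · rcases hKτ τ with ⟨σ, h⟩ | ⟨σ, h⟩
    · rw [h, hR σ r hr]
    · rw [h, hR 1 r hr, hR' σ r hr]
  · rcases hKτ τ with ⟨σ, h⟩ | ⟨σ, h⟩
    · rw [h]
      exact hs σ t ht r hr
    · rw [h, hcd t (Ioo_subset_Icc_self ht)]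
      exact hs' σ t ht r hr

theorem ArcIsotopic.symm {ε : ℤˣ} {R : Set Space} {a b : ℝ} {c e : ℝ → Space}
    (h : ArcIsotopic ε R a b c e) : ArcIsotopic ε R a b e c := by
  obtain ⟨H, hH, hce, hR, hs⟩ := h
  obtain ⟨K, hK, hK1, hKτ⟩ := hH.exists_reverse
  refine ⟨K, hK, fun t ht => by rw [← hce t ht, hK1], fun τ r hr => ?_, fun τ t ht r hr => ?_⟩
  · obtain ⟨σ, h⟩ := hKτ τ
    have := h r
    rwa [hR 1 r hr, hR σ r hr] at this
  · obtain ⟨σ, h⟩ := hKτ τ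
    rw [← hce t (Ioo_subset_Icc_self ht), h]
    exact hs σ t ht r hr

/-- Conjugation by a homeomorphism that preserves vertical lines keeps the relation of lying over
the same point of the plane; this allows `R` to be put in a convenient position first. -/
theorem ArcIsotopic.of_conj {ε ε' : ℤˣ} {R : Set Space} {a b : ℝ} {c e : ℝ → Space}
    (Ψ : Space ≃ₜ Space) (hΨ : ∀ x, (Ψ x).1 = x.1)
    (hside : ∀ x y : Space, x.1 = y.1 → OnSide ε (Ψ x) (Ψ y) → OnSide ε' x y)
    (h : ArcIsotopic ε (Ψ '' R) a b (Ψ ∘ c) (Ψ ∘ e)) : ArcIsotopic ε' R a b c e := by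
  obtain ⟨H, hH, hce, hR, hs⟩ := h
  obtain ⟨K, hK, hKτ⟩ := hH.exists_conj Ψ
  refine ⟨K, hK, fun t ht => ?_, fun τ r hr => ?_, fun τ t ht r hr h1 => ?_⟩
  · have := hce t ht
    simp only [Function.comp_apply] at this
    rw [hKτ, this, Homeomorph.symm_apply_apply]
  · rw [hKτ, hR τ _ (mem_image_of_mem _ hr), Homeomorph.symm_apply_apply]
  · refine hside _ _ h1 ?_
    have h2 := hs τ t ht (Ψ r) (mem_image_of_mem _ hr)
    rw [hKτ, Homeomorph.apply_symm_apply]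
    apply h2
    rw [hΨ r, ← h1, hKτ, ← hΨ (Ψ.symm _), Homeomorph.apply_symm_apply]
    rfl

theorem onSide_neg_one {x y : Space} : OnSide (-1) x y ↔ x.2 < y.2 := by
  have : (-1 : ℤˣ) ≠ 1 := by decide
  simp [OnSide, this]

theorem onSide_one {x y : Space} : OnSide 1 x y ↔ y.2 < x.2 := by
  have : (1 : ℤˣ) ≠ -1 := by decide
  simp [OnSide, this]

/-! ### Vertical isotopies -/

/-- The vertical homeomorphism which shifts the height by a continuous function on the plane. -/
noncomputable def verticalShift (f : C(ℂ, ℝ)) : Space ≃ₜ Space where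
  toFun x := (x.1, x.2 + f x.1)
  invFun x := (x.1, x.2 - f x.1)
  left_inv x := by simp
  right_inv x := by simp
  continuous_toFun := by fun_prop
  continuous_invFun := by fun_prop

@[simp]
theorem verticalShift_apply (f : C(ℂ, ℝ)) (x : Space) :
    verticalShift f x = (x.1, x.2 + f x.1) := rfl

/-- The reflection in the plane of projection. -/
def heightReflection : Space ≃ₜ Space where
  toFun x := (x.1, -x.2)
  invFun x := (x.1, -x.2)
  left_inv x := by simp
  right_inv x := by simp
  continuous_toFun := by fun_prop
  continuous_invFun := by fun_prop

@[simp]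
theorem heightReflection_apply (x : Space) : heightReflection x = (x.1, -x.2) := rfl

/-- Points above the graph of `U` stay fixed. Below it, the depth under the graph is multiplied by
`1 + τ * κ`, which is invertible on each vertical line; the inverse divides the depth by this
factor. -/
theorem exists_isAmbientIsotopy_pushDown (U κ : C(ℂ, ℝ)) (hκ : ∀ x, 0 ≤ κ x) :
    ∃ H : unitInterval → (Space ≃ₜ Space), IsAmbientIsotopy H ∧
      ∀ τ x, H τ x = (x.1, x.2 - τ * κ x.1 * max (U x.1 - x.2) 0) := by
  have hpos : ∀ (τ : unitInterval) (x : ℂ), 0 ≤ (τ : ℝ) * κ x := fun τ x =>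
    mul_nonneg τ.2.1 (hκ x)
  have key1 : ∀ k u z : ℝ, 0 ≤ k →
      (z - k * max (u - z) 0) + k / (1 + k) * max (u - (z - k * max (u - z) 0)) 0 = z := by
    intro k u z hk
    rcases le_total u z with h | h
    · rw [max_eq_right (by linarith : u - z ≤ 0)]
      simp [h]
    · rw [max_eq_left (by linarith : 0 ≤ u - z), max_eq_left (by nlinarith)]
      field_simp
      ring
  have key2 : ∀ k u z : ℝ, 0 ≤ k →
      (z + k / (1 + k) * max (u - z) 0) - k * max (u - (z + k / (1 + k) * max (u - z) 0)) 0 = z := by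
    intro k u z hk
    rcases le_total u z with h | h
    · rw [max_eq_right (by linarith : u - z ≤ 0)]
      simp [h]
    · have h2 : u - (z + k / (1 + k) * (u - z)) = (u - z) / (1 + k) := by
        field_simp
        ring
      rw [max_eq_left (by linarith : 0 ≤ u - z), h2,
        max_eq_left (div_nonneg (by linarith) (by linarith))]
      field_simp
      ring
  refine exists_isAmbientIsotopy_of_inverse
    (fun x => (x.2.1, x.2.2 - x.1 * κ x.2.1 * max (U x.2.1 - x.2.2) 0))
    (fun x => (x.2.1, x.2.2 + (x.1 * κ x.2.1) / (1 + x.1 * κ x.2.1) * max (U x.2.1 - x.2.2) 0))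
    (by fun_prop) ?_ ?_ ?_ ?_
  · refine Continuous.prodMk (by fun_prop) ?_
    refine Continuous.add (by fun_prop) (Continuous.mul (Continuous.div (by fun_prop) (by fun_prop)
      fun x => ?_) (by fun_prop))
    have := hpos x.1 x.2.1
    positivity
  · intro τ x
    exact Prod.ext rfl (key1 _ _ _ (hpos τ x.1))
  · intro τ x
    exact Prod.ext rfl (key2 _ _ _ (hpos τ x.1))
  · intro x
    simp

theorem exists_extension_of_injOn {a b : ℝ} {c : ℝ → ℂ} {g : ℝ → ℝ}
    (hc : ContinuousOn c (Icc a b)) (hinj : InjOn c (Icc a b)) (hg : ContinuousOn g (Icc a b)) :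
    ∃ G : C(ℂ, ℝ), ∀ t ∈ Icc a b, G (c t) = g t := by
  have he : IsClosedEmbedding ((Icc a b).domRestrict c) :=
    (continuousOn_iff_continuous_domRestrict.mp hc).isClosedEmbedding (injOn_iff_injective.mp hinj)
  obtain ⟨G, hG⟩ := ContinuousMap.exists_extension' he
    ⟨(Icc a b).domRestrict g, continuousOn_iff_continuous_domRestrict.mp hg⟩
  exact ⟨G, fun t ht => congrFun hG ⟨t, ht⟩⟩

/-- The arc is pushed down by `exists_isAmbientIsotopy_pushDown` from a ceiling slightly above it.
The ceiling lies below `R` over the interior of the arc, and the push is switched off over those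
points of the plane where `R` reaches below the ceiling. -/
theorem arcIsotopic_of_le {R : Set Space} (hR : IsCompact R) {a b : ℝ}
    {c : ℝ → ℂ} {g₀ g₁ : ℝ → ℝ}
    (hc : ContinuousOn c (Icc a b)) (hinj : InjOn c (Icc a b))
    (hg₀ : ContinuousOn g₀ (Icc a b)) (hg₁ : ContinuousOn g₁ (Icc a b))
    (hle : ∀ t ∈ Icc a b, g₁ t ≤ g₀ t) (ha : g₁ a = g₀ a) (hb : g₁ b = g₀ b)
    (hbelow : ∀ t ∈ Ioo a b, ∀ r ∈ R, r.1 = c t → g₀ t < r.2)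
    (hfin : {t | t ∈ Ioo a b ∧ ∃ r ∈ R, r.1 = c t}.Finite) :
    ArcIsotopic (-1) R a b (fun t => (c t, g₀ t)) (fun t => (c t, g₁ t)) := by
  obtain ⟨G, hG⟩ := exists_extension_of_injOn hc hinj hg₀
  set T := {t | t ∈ Ioo a b ∧ ∃ r ∈ R, r.1 = c t} with hT
  -- Only finitely many interior points of the arc lie under `R`, so the part of `R` over them is
  -- compact and has a positive gap to the arc.
  obtain ⟨δ, hδ, hδR⟩ : ∃ δ > 0, ∀ t ∈ Ioo a b, ∀ r ∈ R, r.1 = c t → g₀ t + δ < r.2 := by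
    have hcomp : IsCompact (R ∩ Prod.fst ⁻¹' (c '' T)) :=
      hR.inter_right ((hfin.image c).isClosed.preimage continuous_fst)
    have hcont : ContinuousOn (fun r : Space => r.2 - G r.1) (R ∩ Prod.fst ⁻¹' (c '' T)) := by
      fun_prop
    obtain ⟨δ, hδ, h⟩ := hcomp.exists_forall_le' hcont (a := 0) (by
      rintro r ⟨hr, t, ht, htr⟩
      rw [← htr, hG t (Ioo_subset_Icc_self ht.1)]
      linarith [hbelow t ht.1 r hr htr.symm])
    refine ⟨δ / 2, by linarith, fun t ht r hr hrt => ?_⟩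
    have := h r ⟨hr, t, ⟨ht, r, hr, hrt⟩, hrt.symm⟩
    rw [hrt, hG t (Ioo_subset_Icc_self ht)] at this
    linarith
  obtain ⟨P, hP⟩ := exists_extension_of_injOn (g := fun t => (g₀ t - g₁ t) / δ) hc hinj (by fun_prop)
  -- The shadow of the part of `R` below the ceiling `G + δ`. By the choice of `δ` it meets the
  -- projected arc at most in the ends, where `g₀ = g₁`. Hence the prescriptions 0 on `Q` and `(g₀ -
  -- g₁) / δ` on the arc agree on the overlap and extend to a continuous `κ'` on the plane.
  set Q : Set ℂ := Prod.fst '' (R ∩ {r | r.2 ≤ G r.1 + δ}) with hQ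
  have hQc : IsClosed Q := by
    refine (IsCompact.image (hR.inter_right ?_) continuous_fst).isClosed
    exact isClosed_le (by fun_prop) (by fun_prop)
  have hKc : IsClosed (c '' Icc a b) := (isCompact_Icc.image_of_continuousOn hc).isClosed
  have hQK : ∀ t ∈ Icc a b, c t ∈ Q → P (c t) = 0 := by
    rintro t ht ⟨r, ⟨hr, hrQ⟩, hrt⟩
    rw [hP t ht]
    by_cases h : t ∈ Ioo a b
    · have := hδR t h r hr hrt
      simp only [mem_ofPred_eq] at hrQ
      rw [hrt, hG t ht] at hrQ
      linarith
    · rcases eq_endpoints_or_mem_Ioo_of_mem_Icc ht with rfl | rfl | h'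
      · simp [ha]
      · simp [hb]
      · exact absurd h' h
  classical
  set f : ℂ → ℝ := fun x => if x ∈ Q then 0 else P x with hf
  have hfc : ContinuousOn f (Q ∪ c '' Icc a b) := by
    refine ContinuousOn.union_of_isClosed ?_ ?_ hQc hKc
    · exact (continuousOn_const (c := (0 : ℝ))).congr fun x hx => by simp [hf, hx]
    · refine P.continuous.continuousOn.congr fun x hx => ?_
      obtain ⟨t, ht, rfl⟩ := hx
      by_cases h : c t ∈ Q
      · simp [hf, h, hQK t ht h]
      · simp [hf, h]
  obtain ⟨κ', hκ'⟩ := ContinuousMap.exists_restrict_eq (hQc.union hKc)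
    ⟨(Q ∪ c '' Icc a b).domRestrict f, continuousOn_iff_continuous_domRestrict.mp hfc⟩
  have hκf : ∀ x ∈ Q ∪ c '' Icc a b, κ' x = f x := fun x hx =>
    congrArg (fun g : C(_, ℝ) => g ⟨x, hx⟩) hκ'
  let κ : C(ℂ, ℝ) := ⟨fun x => max (κ' x) 0, by fun_prop⟩
  have hκQ : ∀ x ∈ Q, κ x = 0 := fun x hx => by
    simp [κ, hκf x (Or.inl hx), hf, hx]
  have hκK : ∀ t ∈ Icc a b, κ (c t) = (g₀ t - g₁ t) / δ := fun t ht => by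
    have h0 : 0 ≤ (g₀ t - g₁ t) / δ := div_nonneg (by linarith [hle t ht]) hδ.le
    have : f (c t) = P (c t) := by
      by_cases h : c t ∈ Q
      · simp [hf, h, hQK t ht h]
      · simp [hf, h]
    simp only [κ, ContinuousMap.coe_mk, hκf (c t) (Or.inr ⟨t, ht, rfl⟩), this, hP t ht]
    exact max_eq_left h0
  let U : C(ℂ, ℝ) := ⟨fun x => G x + δ, by fun_prop⟩
  obtain ⟨H, hH, hHf⟩ := exists_isAmbientIsotopy_pushDown U κ fun x => le_max_right _ _
  have hHc : ∀ τ, ∀ t ∈ Icc a b, H τ (c t, g₀ t) = (c t, g₀ t - τ * (g₀ t - g₁ t)) := by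
    intro τ t ht
    rw [hHf]
    have : U (c t) - g₀ t = δ := by simp [U, hG t ht]
    simp only [this, hκK t ht, max_eq_left hδ.le]
    congr 2
    field_simp
  refine ⟨H, hH, fun t ht => ?_, fun τ r hr => ?_, fun τ t ht r hr h => ?_⟩
  · rw [hHc 1 t ht]
    simp
  · rw [hHf]
    by_cases h : r.1 ∈ Q
    · simp [hκQ r.1 h]
    · have : ¬ r.2 ≤ G r.1 + δ := fun h' => h ⟨r, ⟨hr, h'⟩, rfl⟩
      have h2 : U r.1 - r.2 ≤ 0 := by
        simp only [U, ContinuousMap.coe_mk]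
        linarith
      simp [max_eq_right h2]
  · have ht' := Ioo_subset_Icc_self ht
    rw [hHc τ t ht'] at h ⊢
    rw [onSide_neg_one]
    have h1 := hbelow t ht r hr h.symm
    have h2 : 0 ≤ (τ : ℝ) * (g₀ t - g₁ t) := mul_nonneg τ.2.1 (by linarith [hle t ht'])
    simp only
    linarith

/-- Both height functions can be lowered to their pointwise minimum. -/
theorem arcIsotopic_of_proj_eq {R : Set Space} (hR : IsCompact R) {a b : ℝ}
    {c : ℝ → ℂ} {g₀ g₁ : ℝ → ℝ}
    (hc : ContinuousOn c (Icc a b)) (hinj : InjOn c (Icc a b))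
    (hg₀ : ContinuousOn g₀ (Icc a b)) (hg₁ : ContinuousOn g₁ (Icc a b))
    (ha : g₁ a = g₀ a) (hb : g₁ b = g₀ b)
    (hbelow₀ : ∀ t ∈ Ioo a b, ∀ r ∈ R, r.1 = c t → g₀ t < r.2)
    (hbelow₁ : ∀ t ∈ Ioo a b, ∀ r ∈ R, r.1 = c t → g₁ t < r.2)
    (hfin : {t | t ∈ Ioo a b ∧ ∃ r ∈ R, r.1 = c t}.Finite) :
    ArcIsotopic (-1) R a b (fun t => (c t, g₀ t)) (fun t => (c t, g₁ t)) := by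
  have hm : ContinuousOn (fun t => min (g₀ t) (g₁ t)) (Icc a b) := hg₀.inf hg₁
  exact (arcIsotopic_of_le hR hc hinj hg₀ hm (fun t _ => min_le_left _ _) (by simp [ha])
      (by simp [hb]) hbelow₀ hfin).trans
    (arcIsotopic_of_le hR hc hinj hg₁ hm (fun t _ => min_le_right _ _) (by simp [ha])
      (by simp [hb]) hbelow₁ hfin).symm

/-! ### Isotopies that preserve the height -/

/-- At each height the plane moves by similarities that carry `A` to `A'` and have factor `exp (τ *
l)`, which never vanishes. -/
theorem exists_isAmbientIsotopy_level (A A' l : C(ℝ, ℂ)) :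
    ∃ H : unitInterval → (Space ≃ₜ Space), IsAmbientIsotopy H ∧
      ∀ τ x, H τ x = (A x.2 + (τ : ℝ) * (A' x.2 - A x.2) +
        Complex.exp ((τ : ℝ) * l x.2) * (x.1 - A x.2), x.2) := by
  refine exists_isAmbientIsotopy_of_inverse
    (fun x => (A x.2.2 + (x.1 : ℝ) * (A' x.2.2 - A x.2.2) +
        Complex.exp ((x.1 : ℝ) * l x.2.2) * (x.2.1 - A x.2.2), x.2.2))
    (fun x => (A x.2.2 + Complex.exp (-((x.1 : ℝ) * l x.2.2)) *
      (x.2.1 - (A x.2.2 + (x.1 : ℝ) * (A' x.2.2 - A x.2.2))), x.2.2))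
    (by fun_prop) (by fun_prop) ?_ ?_ ?_
  · intro τ x
    refine Prod.ext ?_ rfl
    simp only [add_sub_cancel_left]
    rw [← mul_assoc, ← Complex.exp_add]
    simp
  · intro τ x
    refine Prod.ext ?_ rfl
    simp only [add_sub_cancel_left]
    rw [← mul_assoc, ← Complex.exp_add]
    simp
  · intro x
    simp

theorem exists_continuous_log (W : C(ℝ, ℂ)) (hW : ∀ x, W x ≠ 0) {x₀ : ℝ} (h : W x₀ = 1) :
    ∃ l : C(ℝ, ℂ), l x₀ = 0 ∧ ∀ x, Complex.exp (l x) = W x := by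
  obtain ⟨l, ⟨hl0, hl⟩, -⟩ := Complex.isCoveringMapOn_exp.existsUnique_continuousMap_lifts W
    (a₀ := x₀) (e₀ := 0) (by simp [h]) (fun a => by simpa using hW a)
  exact ⟨l, hl0, fun x => congrFun hl x⟩

/-- The difference of the two points of the arc `c` which divide the parts of `[a, b]` after and
before `m` in the same ratio `ζ`. -/
def armDifference (c : ℝ → ℂ) (a m b ζ : ℝ) : ℂ :=
  c (m + (b - m) * ζ) - c (m - (m - a) * ζ)

section

variable {c : ℝ → ℂ} {a m b : ℝ}

theorem arm_right_mem (ham : a < m) (hmb : m < b) {ζ : ℝ} (hζ : ζ ∈ Icc (0 : ℝ) 1) :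
    m + (b - m) * ζ ∈ Icc a b :=
  ⟨by nlinarith [hζ.1], by nlinarith [hζ.2]⟩

theorem arm_left_mem (ham : a < m) (hmb : m < b) {ζ : ℝ} (hζ : ζ ∈ Icc (0 : ℝ) 1) :
    m - (m - a) * ζ ∈ Icc a b :=
  ⟨by nlinarith [hζ.2], by nlinarith [hζ.1]⟩

/-- Dividing the difference by `ζ` removes its zero at the bottom of the arc; differentiability at
`m` supplies the limit there, which is nonzero as soon as `v` is. -/
theorem continuousOn_dslope_armDifference (ham : a < m) (hmb : m < b)
    (hc : ContinuousOn c (Icc a b)) {v : ℂ} (hv : HasDerivAt c v m) :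
    ContinuousOn (dslope (armDifference c a m b) 0) (Icc 0 1) ∧
      dslope (armDifference c a m b) 0 0 = (b - a) • v := by
  have h1 : HasDerivAt (armDifference c a m b) ((b - m) • v - (-(m - a)) • v) 0 := by
    have hr : HasDerivAt (fun ζ : ℝ => m + (b - m) * ζ) (b - m) 0 := by
      simpa using ((hasDerivAt_id (0 : ℝ)).const_mul (b - m)).const_add m
    have hl : HasDerivAt (fun ζ : ℝ => m - (m - a) * ζ) (-(m - a)) 0 := by
      simpa using ((hasDerivAt_id (0 : ℝ)).const_mul (m - a)).const_sub m
    exact (HasDerivAt.scomp_of_eq (0 : ℝ) hv hr (by simp)).sub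
      (HasDerivAt.scomp_of_eq (0 : ℝ) hv hl (by simp))
  -- Continuity of `dslope` is available on a neighbourhood of 0 only, so `ζ` is allowed to be
  -- slightly negative; `η` keeps both parameters inside `[a, b]`.
  set η := min ((m - a) / (b - m)) ((b - m) / (m - a)) with hη
  have hbm : 0 < b - m := by linarith
  have hma : 0 < m - a := by linarith
  have hη0 : 0 < η := lt_min (div_pos hma hbm) (div_pos hbm hma)
  have hη1 : (b - m) * η ≤ m - a := by
    rw [mul_comm, ← le_div_iff₀ hbm]
    exact min_le_left _ _
  have hη2 : (m - a) * η ≤ b - m := by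
    rw [mul_comm, ← le_div_iff₀ hma]
    exact min_le_right _ _
  have hcont : ContinuousOn (armDifference c a m b) (Icc (-η) 1) := by
    refine ContinuousOn.sub (hc.comp (by fun_prop) ?_) (hc.comp (by fun_prop) ?_)
    · intro ζ hζ
      exact ⟨by nlinarith [hζ.1], by nlinarith [hζ.2]⟩
    · intro ζ hζ
      exact ⟨by nlinarith [hζ.2], by nlinarith [hζ.1]⟩
  constructor
  · exact ((continuousOn_dslope (Icc_mem_nhds (by linarith) one_pos)).mpr
      ⟨hcont, h1.differentiableAt⟩).mono (Icc_subset_Icc (by linarith) le_rfl)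
  · rw [dslope_same, h1.deriv, ← sub_smul]
    congr 1
    ring

theorem smul_dslope_armDifference (ζ : ℝ) :
    ζ • dslope (armDifference c a m b) 0 ζ = armDifference c a m b ζ := by
  have := sub_smul_dslope (armDifference c a m b) 0 ζ
  simpa [armDifference] using this

theorem dslope_armDifference_ne_zero (ham : a < m) (hmb : m < b)
    (hc : ContinuousOn c (Icc a b)) (hinj : InjOn c (Icc a b)) {v : ℂ} (hv0 : v ≠ 0)
    (hv : HasDerivAt c v m) {ζ : ℝ} (hζ : ζ ∈ Icc (0 : ℝ) 1) :
    dslope (armDifference c a m b) 0 ζ ≠ 0 := by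
  rcases hζ.1.eq_or_lt with rfl | h
  · rw [(continuousOn_dslope_armDifference ham hmb hc hv).2]
    exact smul_ne_zero (by linarith) hv0
  · intro h0
    have h1 := smul_dslope_armDifference (c := c) (a := a) (m := m) (b := b) ζ
    rw [h0, smul_zero, eq_comm, armDifference, sub_eq_zero] at h1
    have := hinj (arm_right_mem ham hmb hζ) (arm_left_mem ham hmb hζ) h1
    nlinarith

end

/-- At a height strictly between -1 and 0 each arc has exactly two points, one on either side of
`m`, and a unique complex similarity matches the pairs. At height -1 the pairs merge, and the ratio
of derivatives takes the place of the ratio of differences. -/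
theorem arcIsotopic_of_height_eq {R : Set Space} (hR : ∀ r ∈ R, 0 ≤ r.2) {a m b : ℝ} (ham : a < m)
    (hmb : m < b) {c e : ℝ → ℂ}
    (hc : ContinuousOn c (Icc a b)) (hcinj : InjOn c (Icc a b))
    (he : ContinuousOn e (Icc a b)) (heinj : InjOn e (Icc a b))
    {v w : ℂ} (hv0 : v ≠ 0) (hv : HasDerivAt c v m) (hw0 : w ≠ 0) (hw : HasDerivAt e w m)
    (hea : c a = e a) (heb : c b = e b) {h : ℝ → ℝ}
    (hh : h = fun t => -min ((t - a) / (m - a)) ((b - t) / (b - m))) :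
    ArcIsotopic (-1) R a b (fun t => (c t, h t)) (fun t => (e t, h t)) := by
  have hbm : 0 < b - m := by linarith
  have hma : 0 < m - a := by linarith
  -- The height as a position on the arms of the V: 0 at the bottom and below, 1 at height 0 and
  -- above.
  set ζ : ℝ → ℝ := fun z => max 0 (min 1 (1 + z)) with hζ
  have hζc : Continuous ζ := by fun_prop
  have hζm : ∀ z, ζ z ∈ Icc (0 : ℝ) 1 := fun z =>
    ⟨le_max_left _ _, max_le zero_le_one (min_le_left _ _)⟩
  let A : C(ℝ, ℂ) := ⟨fun z => c (m - (m - a) * ζ z),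
    hc.comp_continuous (by fun_prop) fun z => arm_left_mem ham hmb (hζm z)⟩
  let A' : C(ℝ, ℂ) := ⟨fun z => e (m - (m - a) * ζ z),
    he.comp_continuous (by fun_prop) fun z => arm_left_mem ham hmb (hζm z)⟩
  let W : C(ℝ, ℂ) :=
    ⟨fun z => dslope (armDifference e a m b) 0 (ζ z) / dslope (armDifference c a m b) 0 (ζ z),
    Continuous.div
      ((continuousOn_dslope_armDifference ham hmb he hw).1.comp_continuous hζc hζm)
      ((continuousOn_dslope_armDifference ham hmb hc hv).1.comp_continuous hζc hζm)
      fun z => dslope_armDifference_ne_zero ham hmb hc hcinj hv0 hv (hζm z)⟩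
  have hζ0 : ∀ z, 0 ≤ z → ζ z = 1 := fun z hz => by
    simp [hζ, hz]
  have hW1 : W 0 = 1 := by
    simp only [W, ContinuousMap.coe_mk, hζ0 0 le_rfl]
    have h1 := dslope_armDifference_ne_zero ham hmb hc hcinj hv0 hv (right_mem_Icc.mpr zero_le_one)
    have h2 : dslope (armDifference e a m b) 0 1 = dslope (armDifference c a m b) 0 1 := by
      rw [← one_smul ℝ (dslope (armDifference e a m b) 0 1), smul_dslope_armDifference,
        ← one_smul ℝ (dslope (armDifference c a m b) 0 1), smul_dslope_armDifference]
      simp [armDifference, hea, heb]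
    rw [h2, div_self h1]
  have hWmul : ∀ z, W z * armDifference c a m b (ζ z) = armDifference e a m b (ζ z) := by
    intro z
    rw [← smul_dslope_armDifference, ← smul_dslope_armDifference]
    have h1 := dslope_armDifference_ne_zero ham hmb hc hcinj hv0 hv (hζm z)
    simp only [W, ContinuousMap.coe_mk, Complex.real_smul]
    field_simp
  obtain ⟨l₀, hl0, hl⟩ := exists_continuous_log W (fun z => div_ne_zero
    (dslope_armDifference_ne_zero ham hmb he heinj hw0 hw (hζm z))
    (dslope_armDifference_ne_zero ham hmb hc hcinj hv0 hv (hζm z))) hW1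
  -- The truncation makes the logarithm vanish at all heights at least 0, where `R` lies and has to
  -- stay fixed.
  let l : C(ℝ, ℂ) := ⟨fun z => l₀ (min z 0), by fun_prop⟩
  obtain ⟨H, hH, hHf⟩ := exists_isAmbientIsotopy_level A A' l
  have hneg : ∀ t ∈ Ioo a b, h t < 0 := fun t ht => by
    rw [hh]
    exact neg_lt_zero.mpr (lt_min (div_pos (by linarith [ht.1]) hma)
      (div_pos (by linarith [ht.2]) hbm))
  have hnonpos : ∀ t ∈ Icc a b, h t ≤ 0 := fun t ht => by
    rw [hh]
    exact neg_nonpos.mpr (le_min (div_nonneg (by linarith [ht.1]) hma.le)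
      (div_nonneg (by linarith [ht.2]) hbm.le))
  refine ⟨H, hH, fun t ht => ?_, fun τ r hr => ?_, fun τ t ht r hr _ => ?_⟩
  · rw [hHf]
    refine Prod.ext ?_ rfl
    have hexp : Complex.exp (l (h t)) = W (h t) := by
      simp only [l, ContinuousMap.coe_mk, min_eq_left (hnonpos t ht), hl]
    simp only [Set.Icc.coe_one, Complex.ofReal_one, one_mul, hexp, add_sub_cancel]
    -- Points with `t ≤ m` are the centres `A` of the similarities and go to `A'`. For `t ≥ m` the
    -- vector from the centre is multiplied by `W`, which turns the difference of the `c`-pair into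
    -- that of the `e`-pair.
    rcases le_total t m with htm | htm
    · have h1 : (t - a) / (m - a) ≤ 1 := (div_le_one hma).mpr (by linarith)
      have h2 : 1 ≤ (b - t) / (b - m) := (one_le_div hbm).mpr (by linarith)
      have h3 : ζ (h t) = (m - t) / (m - a) := by
        simp only [hζ, hh, min_eq_left (h1.trans h2)]
        have : 1 + -((t - a) / (m - a)) = (m - t) / (m - a) := by field_simp; ring
        rw [this, min_eq_right ((div_le_one hma).mpr (by linarith [ht.1])),
          max_eq_right (div_nonneg (by linarith) hma.le)]
      have h4 : m - (m - a) * ζ (h t) = t := by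
        rw [h3]
        field_simp
        ring
      have hA : A (h t) = c t := by simp only [A, ContinuousMap.coe_mk, h4]
      have hA' : A' (h t) = e t := by simp only [A', ContinuousMap.coe_mk, h4]
      rw [hA, hA']
      simp
    · have h1 : 1 ≤ (t - a) / (m - a) := (one_le_div hma).mpr (by linarith)
      have h2 : (b - t) / (b - m) ≤ 1 := (div_le_one hbm).mpr (by linarith)
      have h3 : ζ (h t) = (t - m) / (b - m) := by
        simp only [hζ, hh, min_eq_right (h2.trans h1)]
        have : 1 + -((b - t) / (b - m)) = (t - m) / (b - m) := by field_simp; ring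
        rw [this, min_eq_right ((div_le_one hbm).mpr (by linarith [ht.2])),
          max_eq_right (div_nonneg (by linarith) hbm.le)]
      have h4 : m + (b - m) * ζ (h t) = t := by
        rw [h3]
        field_simp
        ring
      have h5 : c t - A (h t) = armDifference c a m b (ζ (h t)) := by
        simp only [A, ContinuousMap.coe_mk, armDifference, h4]
      have h6 : e t - A' (h t) = armDifference e a m b (ζ (h t)) := by
        simp only [A', ContinuousMap.coe_mk, armDifference, h4]
      rw [h5, hWmul, ← h6]
      ring
  · have h1 := hζ0 r.2 (hR r hr)
    have hA : A' r.2 = A r.2 := by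
      simp only [A, A', ContinuousMap.coe_mk, h1, mul_one, sub_sub_cancel, hea]
    have hl' : l r.2 = 0 := by
      simp only [l, ContinuousMap.coe_mk, min_eq_right (hR r hr), hl0]
    rw [hHf, hA, hl']
    simp
  · rw [hHf, onSide_neg_one]
    exact (hneg t ht).trans_le (hR r hr)

/-- The arc `c` with parameters in `[a, b]` has a simple projection, is differentiable at `m`, and
passes `R` on one side, above for `ε = 1` and below for `ε = -1`. -/
structure IsPassingArc (ε : ℤˣ) (R : Set Space) (a m b : ℝ) (c : ℝ → Space) : Prop where
  continuousOn : ContinuousOn c (Icc a b)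
  injOn : InjOn (fun t => (c t).1) (Icc a b)
  onSide : ∀ t ∈ Ioo a b, ∀ r ∈ R, r.1 = (c t).1 → OnSide ε (c t) r
  finite : {t | t ∈ Ioo a b ∧ ∃ r ∈ R, r.1 = (c t).1}.Finite
  hasDerivAt : ∃ v : ℂ, v ≠ 0 ∧ HasDerivAt (fun t => (c t).1) v m

/-- Near `x`, the set `R` is not steeper than some slope. -/
def BoundedSlopeAt (R : Set Space) (x : Space) : Prop :=
  ∃ C : ℝ, ∀ r ∈ R, |r.2 - x.2| ≤ C * ‖r.1 - x.1‖

theorem BoundedSlopeAt.mono {R S : Set Space} {x : Space} (h : BoundedSlopeAt S x) (hRS : R ⊆ S) :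
    BoundedSlopeAt R x :=
  h.imp fun _ hC r hr => hC r (hRS hr)

/-- Bounded slope at the two ends means that `R` lies above two downward cones with apices at the
ends. Subtracting the upper envelope of the cones lifts `R` to heights at least 0, after which the
arcs are pushed to a common height profile and matched level by level. -/
theorem arcIsotopic_neg_one {R : Set Space} (hR : IsCompact R) {a m b : ℝ} (ham : a < m)
    (hmb : m < b) {c e : ℝ → Space} (hc : IsPassingArc (-1) R a m b c)
    (he : IsPassingArc (-1) R a m b e) (hea : c a = e a) (heb : c b = e b)
    (ha : BoundedSlopeAt R (c a)) (hb : BoundedSlopeAt R (c b)) (hbR : c b ∈ R) :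
    ArcIsotopic (-1) R a b c e := by
  obtain ⟨C₁, hC₁⟩ := ha
  obtain ⟨C₂, hC₂⟩ := hb
  set C := max (max C₁ C₂) 0 with hC
  have hbm : 0 < b - m := by linarith
  have hma : 0 < m - a := by linarith
  have hCa : ∀ r ∈ R, |r.2 - (c a).2| ≤ C * ‖r.1 - (c a).1‖ := fun r hr =>
    (hC₁ r hr).trans (by gcongr; exact (le_max_left _ _).trans (le_max_left _ _))
  have hCb : ∀ r ∈ R, |r.2 - (c b).2| ≤ C * ‖r.1 - (c b).1‖ := fun r hr =>
    (hC₂ r hr).trans (by gcongr; exact (le_max_right _ _).trans (le_max_left _ _))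
  let f : C(ℂ, ℝ) := ⟨fun x => min (-(c a).2 + C * ‖x - (c a).1‖) (-(c b).2 + C * ‖x - (c b).1‖),
    by fun_prop⟩
  have hfR : ∀ r ∈ R, 0 ≤ r.2 + f r.1 := by
    intro r hr
    have h1 := abs_le.mp (hCa r hr)
    have h2 := abs_le.mp (hCb r hr)
    have : -r.2 ≤ f r.1 := le_min (by linarith [h1.1]) (by linarith [h2.1])
    linarith
  -- As `c b` belongs to `R`, neither apex lies below the other cone. Hence the envelope passes
  -- through both apices, and the shear brings both ends to height 0.
  have hab' := abs_le.mp (hCa (c b) hbR)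
  have hfa : f (c a).1 = -(c a).2 := by
    have : -(c a).2 ≤ -(c b).2 + C * ‖(c a).1 - (c b).1‖ := by
      rw [norm_sub_rev]
      linarith [hab'.2]
    simpa [f] using this
  have hfb : f (c b).1 = -(c b).2 := by
    have : -(c b).2 ≤ -(c a).2 + C * ‖(c b).1 - (c a).1‖ := by
      linarith [hab'.1]
    simpa [f] using this
  set h : ℝ → ℝ := fun t => -min ((t - a) / (m - a)) ((b - t) / (b - m)) with hh
  have hhc : Continuous h := by fun_prop
  have hha : h a = 0 := by
    have : 0 ≤ (b - a) / (b - m) := div_nonneg (by linarith) hbm.le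
    simp [hh, this]
  have hhb : h b = 0 := by
    have : 0 ≤ (b - a) / (m - a) := div_nonneg (by linarith) hma.le
    simp [hh, this]
  have hneg : ∀ t ∈ Ioo a b, h t < 0 := fun t ht =>
    neg_lt_zero.mpr (lt_min (div_pos (by linarith [ht.1]) hma) (div_pos (by linarith [ht.2]) hbm))
  have key : ∀ d : ℝ → Space, IsPassingArc (-1) R a m b d → c a = d a → c b = d b →
      ArcIsotopic (-1) (verticalShift f '' R) a b (fun t => ((d t).1, (d t).2 + f (d t).1))
        (fun t => ((d t).1, h t)) := by
    intro d hd hda hdb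
    have hd1 : ContinuousOn (fun t => (d t).1) (Icc a b) := hd.continuousOn.fst
    have hd2 : ContinuousOn (fun t => (d t).2) (Icc a b) := hd.continuousOn.snd
    refine arcIsotopic_of_proj_eq (hR.image (verticalShift f).continuous) hd1
      hd.injOn (hd2.add (f.continuous.comp_continuousOn hd1)) hhc.continuousOn ?_ ?_ ?_ ?_ ?_
    · rw [hha, ← hda, hfa, add_neg_cancel]
    · rw [hhb, ← hdb, hfb, add_neg_cancel]
    · rintro t ht _ ⟨r, hr, rfl⟩ h1
      have := onSide_neg_one.mp (hd.onSide t ht r hr h1)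
      simp only [verticalShift_apply] at h1 ⊢
      rw [h1]
      linarith
    · rintro t ht _ ⟨r, hr, rfl⟩ h1
      exact (hneg t ht).trans_le (hfR r hr)
    · refine hd.finite.subset ?_
      rintro t ⟨ht, _, ⟨r, hr, rfl⟩, h1⟩
      exact ⟨ht, r, hr, h1⟩
  obtain ⟨v, hv0, hv⟩ := hc.hasDerivAt
  obtain ⟨w, hw0, hw⟩ := he.hasDerivAt
  have hlevel : ArcIsotopic (-1) (verticalShift f '' R) a b (fun t => ((c t).1, h t))
      (fun t => ((e t).1, h t)) := by
    refine arcIsotopic_of_height_eq ?_ ham hmb hc.continuousOn.fst hc.injOn he.continuousOn.fst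
      he.injOn hv0 hv hw0 hw (by rw [hea]) (by rw [heb]) hh
    rintro _ ⟨r, hr, rfl⟩
    exact hfR r hr
  refine ArcIsotopic.of_conj (ε := -1) (verticalShift f) (fun _ => rfl) ?_
    (((key c hc rfl rfl).trans hlevel).trans (key e he hea heb).symm)
  intro x y hxy hs
  rw [onSide_neg_one] at hs ⊢
  simp only [verticalShift_apply, hxy] at hs
  linarith

/-- Two arcs with the same endpoints which pass a compact set on the same side are isotopic. -/
theorem arcIsotopic_of_isPassingArc {ε : ℤˣ} {R : Set Space} (hR : IsCompact R) {a m b : ℝ}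
    (ham : a < m) (hmb : m < b) {c e : ℝ → Space} (hc : IsPassingArc ε R a m b c)
    (he : IsPassingArc ε R a m b e) (hea : c a = e a) (heb : c b = e b)
    (ha : BoundedSlopeAt R (c a)) (hb : BoundedSlopeAt R (c b)) (hbR : c b ∈ R) :
    ArcIsotopic ε R a b c e := by
  rcases Int.units_eq_one_or ε with rfl | rfl
  · have hslope : ∀ x, BoundedSlopeAt R x →
        BoundedSlopeAt (heightReflection '' R) (heightReflection x) := by
      rintro x ⟨C, hC⟩
      refine ⟨C, ?_⟩
      rintro _ ⟨r, hr, rfl⟩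
      have := hC r hr
      rw [abs_sub_comm] at this
      simpa [neg_add_eq_sub] using this
    have harc : ∀ d, IsPassingArc 1 R a m b d →
        IsPassingArc (-1) (heightReflection '' R) a m b (heightReflection ∘ d) := by
      intro d hd
      refine ⟨heightReflection.continuous.comp_continuousOn hd.continuousOn, hd.injOn, ?_, ?_,
        hd.hasDerivAt⟩
      · rintro t ht _ ⟨r, hr, rfl⟩ h1
        have := onSide_one.mp (hd.onSide t ht r hr h1)
        rw [onSide_neg_one]
        simpa using this
      · refine hd.finite.subset ?_
        rintro t ⟨ht, _, ⟨r, hr, rfl⟩, h1⟩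
        exact ⟨ht, r, hr, h1⟩
    refine ArcIsotopic.of_conj (ε := -1) heightReflection (fun _ => rfl) ?_
      (arcIsotopic_neg_one (hR.image heightReflection.continuous) ham hmb (harc c hc) (harc e he)
        (congrArg _ hea) (congrArg _ heb) (hslope _ ha) (hslope _ hb) (mem_image_of_mem _ hbR))
    intro x y _ hs
    rw [onSide_neg_one] at hs
    rw [onSide_one]
    simpa using hs
  · exact arcIsotopic_neg_one hR ham hmb hc he hea heb ha hb hbR

/-! ### Straightening an arc of a diagram -/

/-- The curve `k` with its part on `[a, b]` replaced by the chord. -/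
noncomputable def chordFun (k : ℝ → Space) (a b t : ℝ) : Space :=
  if a ≤ t ∧ t ≤ b then k a + ((t - a) / (b - a)) • (k b - k a) else k t

theorem chordFun_of_mem {k : ℝ → Space} {a b t : ℝ} (ht : t ∈ Icc a b) :
    chordFun k a b t = k a + ((t - a) / (b - a)) • (k b - k a) :=
  if_pos ht

theorem chordFun_of_notMem_Ioo {k : ℝ → Space} {a b t : ℝ} (hab : a < b) (ht : t ∉ Ioo a b) :
    chordFun k a b t = k t := by
  by_cases h : t ∈ Icc a b
  · rw [chordFun_of_mem h]
    rcases eq_endpoints_or_mem_Ioo_of_mem_Icc h with rfl | rfl | h'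
    · simp
    · rw [div_self (by linarith), one_smul, add_sub_cancel]
    · exact absurd h' ht
  · exact if_neg h

theorem chordFun_fst_of_mem {k : ℝ → Space} {a b t : ℝ} (ht : t ∈ Icc a b) :
    (chordFun k a b t).1 = (k a).1 + ((t - a) / (b - a)) • ((k b).1 - (k a).1) := by
  rw [chordFun_of_mem ht]
  rfl

theorem continuousOn_chordFun {k : ℝ → Space} {a b : ℝ} :
    ContinuousOn (chordFun k a b) (Icc a b) := by
  have : Continuous fun t : ℝ => k a + ((t - a) / (b - a)) • (k b - k a) := by fun_prop
  exact this.continuousOn.congr fun t ht => chordFun_of_mem ht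

theorem injOn_chordFun_fst {k : ℝ → Space} {a b : ℝ} (hab : a < b) (hne : (k a).1 ≠ (k b).1) :
    InjOn (fun t => (chordFun k a b t).1) (Icc a b) := by
  intro x hx y hy hxy
  simp only [chordFun_fst_of_mem hx, chordFun_fst_of_mem hy, add_right_inj] at hxy
  have h := smul_left_injective ℝ (sub_ne_zero.mpr hne.symm) hxy
  have hba : b - a ≠ 0 := by linarith
  field_simp at h
  linarith

theorem affineAt_chordFun_of_mem {k : ℝ → Space} {a b t : ℝ} (ht : t ∈ Ioo a b) :
    AffineAt (chordFun k a b) t := by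
  refine ⟨(1 / (b - a)) • (k b - k a), ?_⟩
  filter_upwards [Ioo_mem_nhds ht.1 ht.2] with s hs
  rw [chordFun_of_mem (Ioo_subset_Icc_self hs), chordFun_of_mem (Ioo_subset_Icc_self ht), add_assoc,
    smul_smul, ← add_smul]
  congr 2
  ring

theorem affineAt_chordFun_of_notMem {k : ℝ → Space} {a b t : ℝ} (ht : t ∉ Icc a b)
    (hk : AffineAt k t) : AffineAt (chordFun k a b) t := by
  obtain ⟨v, hv⟩ := hk
  refine ⟨v, ?_⟩
  filter_upwards [hv, isClosed_Icc.isOpen_compl.mem_nhds ht] with s hs hs'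
  exact (if_neg hs').trans (hs.trans (congrArg (· + (s - t) • v) (if_neg ht).symm))

theorem AffineAt.exists_hasDerivAt {k : ℝ → Space} {t : ℝ} (h : AffineAt k t) :
    ∃ v : Space, HasDerivAt (fun s => (k s).1) v.1 t ∧ ∀ᶠ s in 𝓝 t, k s = k t + (s - t) • v := by
  obtain ⟨v, hv⟩ := h
  refine ⟨v, ?_, hv⟩
  have h1 : HasDerivAt (fun s : ℝ => (k t).1 + (s - t) • v.1) v.1 t := by
    simpa using (((hasDerivAt_id t).sub_const t).smul_const v.1).const_add (k t).1
  refine h1.congr_of_eventuallyEq ?_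
  filter_upwards [hv] with s hs
  rw [hs]
  rfl

namespace KnotDiagram

variable {D : KnotDiagram} {a b s t : ℝ}

theorem mem_crossingTimes_of_eq (hs : s ∈ Ico (0 : ℝ) 1) (ht : t ∈ Ico (0 : ℝ) 1) (hne : s ≠ t)
    (h : D.proj s = D.proj t) : t ∈ D.crossingTimes :=
  ⟨ht, s, hs, hne, h⟩

theorem proj_one : D.proj 1 = D.proj 0 := congrArg Prod.fst D.closed.symm

theorem continuousOn_proj : ContinuousOn D.proj (Icc 0 1) := D.continuousOn.fst

/-- A time outside of `[0, 1)` can be replaced by one inside. -/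
theorem exists_mem_Ico (ht : t ∈ Icc (0 : ℝ) 1) :
    ∃ s ∈ Ico (0 : ℝ) 1, D.toFun s = D.toFun t ∧ (s = t ∨ s = 0 ∧ t = 1) := by
  rcases ht.2.eq_or_lt with rfl | h
  · exact ⟨0, by simp, D.closed, Or.inr ⟨rfl, rfl⟩⟩
  · exact ⟨t, ⟨ht.1, h⟩, rfl, Or.inl rfl⟩

theorem proj_ne_of_notMem_crossingTimes (ha : a ∈ Ioo (0 : ℝ) 1) (hac : a ∉ D.crossingTimes)
    (ht : t ∈ Icc (0 : ℝ) 1) (hne : t ≠ a) : D.proj t ≠ D.proj a := by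
  intro h
  obtain ⟨s, hs, hst, hs'⟩ := exists_mem_Ico (D := D) ht
  refine hac (mem_crossingTimes_of_eq hs ⟨ha.1.le, ha.2⟩ ?_ ((congrArg Prod.fst hst).trans h))
  rcases hs' with rfl | ⟨rfl, rfl⟩
  · exact hne
  · exact ha.1.ne

/-- The arc with parameters in `[a, b]` can be replaced by its chord without creating crossings. -/
structure IsReplaceable (D : KnotDiagram) (a b : ℝ) : Prop where
  zero_lt : 0 < a
  lt : a < b
  lt_one : b < 1
  left : a ∉ D.crossingTimes
  right : b ∉ D.crossingTimes
  free : ∀ t ∈ Ioo a b, ∀ s ∈ Icc (0 : ℝ) 1 \ Ioo a b, (chordFun D.toFun a b t).1 ≠ D.proj s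

theorem IsReplaceable.proj_ne (h : D.IsReplaceable a b) : D.proj a ≠ D.proj b := by
  have h1 := h.zero_lt
  have h2 := h.lt
  have h3 := h.lt_one
  exact (proj_ne_of_notMem_crossingTimes ⟨h1, h2.trans h3⟩ h.left ⟨by linarith, h3.le⟩ h2.ne').symm

/-- The chord has no double points of its own, meets nothing else in its interior, and its ends were
not crossings. So every double point of the new curve is an old one, away from the chord; the
statement is used once for each of its two times. -/
theorem IsReplaceable.of_proj_eq (h : D.IsReplaceable a b) (hs : s ∈ Ico (0 : ℝ) 1)
    (ht : t ∈ Ico (0 : ℝ) 1) (hne : s ≠ t)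
    (hst : (chordFun D.toFun a b s).1 = (chordFun D.toFun a b t).1) :
    t ∉ Icc a b ∧ chordFun D.toFun a b t = D.toFun t := by
  have h1 := h.zero_lt
  have h2 := h.lt
  have h3 := h.lt_one
  have main : t ∉ Icc a b := by
    intro htab
    by_cases hsab : s ∈ Icc a b
    · exact hne (injOn_chordFun_fst h2 h.proj_ne hsab htab hst)
    · have hs' : s ∉ Ioo a b := fun h' => hsab (Ioo_subset_Icc_self h')
      rw [chordFun_of_notMem_Ioo h2 hs'] at hst
      by_cases ht' : t ∈ Ioo a b
      · exact h.free t ht' s ⟨⟨hs.1, hs.2.le⟩, hs'⟩ hst.symm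
      · rw [chordFun_of_notMem_Ioo h2 ht'] at hst
        have : t ∈ D.crossingTimes := mem_crossingTimes_of_eq hs ht hne hst
        rcases eq_endpoints_or_mem_Ioo_of_mem_Icc htab with rfl | rfl | h'
        · exact h.left this
        · exact h.right this
        · exact ht' h'
  exact ⟨main, chordFun_of_notMem_Ioo h2 fun h' => main (Ioo_subset_Icc_self h')⟩

theorem IsReplaceable.mem_crossingTimesOf (h : D.IsReplaceable a b) :
    t ∈ crossingTimesOf (chordFun D.toFun a b) ↔ t ∈ Ico (0 : ℝ) 1 ∧ t ∉ Icc a b ∧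
      ∃ s ∈ Ico (0 : ℝ) 1, s ∉ Icc a b ∧ s ≠ t ∧ D.proj s = D.proj t := by
  constructor
  · rintro ⟨ht, s, hs, hne, hst⟩
    obtain ⟨h1, h2⟩ := h.of_proj_eq hs ht hne hst
    obtain ⟨h3, h4⟩ := h.of_proj_eq ht hs hne.symm hst.symm
    rw [h2, h4] at hst
    exact ⟨ht, h1, s, hs, h3, hne, hst⟩
  · rintro ⟨ht, ht', s, hs, hs', hne, hst⟩
    refine ⟨ht, s, hs, hne, ?_⟩
    rwa [chordFun_of_notMem_Ioo h.lt fun h' => ht' (Ioo_subset_Icc_self h'),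
      chordFun_of_notMem_Ioo h.lt fun h' => hs' (Ioo_subset_Icc_self h')]

theorem IsReplaceable.crossingTimesOf_subset (h : D.IsReplaceable a b) :
    crossingTimesOf (chordFun D.toFun a b) ⊆ D.crossingTimes := fun _ ht => by
  obtain ⟨ht, -, s, hs, -, hne, hst⟩ := h.mem_crossingTimesOf.mp ht
  exact ⟨ht, s, hs, hne, hst⟩

/-- The diagram in which the arc with parameters in `[a, b]` is replaced by its chord. -/
noncomputable def replaceChord (D : KnotDiagram) (a b : ℝ) (h : D.IsReplaceable a b) :
    KnotDiagram where
  toFun := chordFun D.toFun a b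
  closed := by
    rw [chordFun_of_notMem_Ioo h.lt fun h' => h.zero_lt.not_gt h'.1,
      chordFun_of_notMem_Ioo h.lt fun h' => h.lt_one.not_gt h'.2, D.closed]
  continuousOn := by
    have h0 := h.zero_lt
    have h1 := h.lt_one
    have hl : ContinuousOn (chordFun D.toFun a b) (Icc 0 a) :=
      (D.continuousOn.mono (Icc_subset_Icc le_rfl (by linarith [h.lt]))).congr
        fun t ht => chordFun_of_notMem_Ioo h.lt fun h' => ht.2.not_gt h'.1
    have hr : ContinuousOn (chordFun D.toFun a b) (Icc b 1) :=
      (D.continuousOn.mono (Icc_subset_Icc (by linarith [h.lt]) le_rfl)).congr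
        fun t ht => chordFun_of_notMem_Ioo h.lt fun h' => ht.1.not_gt h'.2
    have := (hl.union_of_isClosed continuousOn_chordFun isClosed_Icc isClosed_Icc).union_of_isClosed
      hr (isClosed_Icc.union isClosed_Icc) isClosed_Icc
    rwa [Icc_union_Icc_eq_Icc h0.le h.lt.le, Icc_union_Icc_eq_Icc (h0.trans h.lt).le h1.le] at this
  polygonal := by
    refine (D.polygonal.union (Set.toFinite {a, b})).subset ?_
    rintro t ⟨ht, hta⟩
    by_cases hab : t ∈ Icc a b
    · rcases eq_endpoints_or_mem_Ioo_of_mem_Icc hab with rfl | rfl | h'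
      · simp
      · simp
      · exact absurd (affineAt_chordFun_of_mem h') hta
    · exact Or.inl ⟨ht, fun h' => hta (affineAt_chordFun_of_notMem hab h')⟩
  injOn := by
    intro x hx y hy hxy
    by_contra hne
    have h1 := (h.of_proj_eq hx hy hne (congrArg Prod.fst hxy)).2
    have h2 := (h.of_proj_eq hy hx (Ne.symm hne) (congrArg Prod.fst hxy.symm)).2
    rw [h1, h2] at hxy
    exact hne (D.injOn hx hy hxy)
  finite_crossings := D.finite_crossings.subset h.crossingTimesOf_subset
  no_triple := by
    rintro r hr s hs t ht hrs hrt hst ⟨h1, h2⟩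
    have e1 := (h.of_proj_eq hr hs hrs h1).2
    have e2 := (h.of_proj_eq hs hr hrs.symm h1.symm).2
    have e3 := (h.of_proj_eq hs ht hst h2).2
    rw [e1, e2] at h1
    rw [e1, e3] at h2
    exact D.no_triple r hr s hs t ht hrs hrt hst ⟨h1, h2⟩
  crossing_interior := by
    intro t ht
    have h1 := D.crossing_interior t (h.crossingTimesOf_subset ht)
    exact ⟨h1.1, affineAt_chordFun_of_notMem (h.mem_crossingTimesOf.mp ht).2.1 h1.2⟩

section

variable (h : D.IsReplaceable a b)

theorem replaceChord_toFun_of_notMem (ht : t ∉ Ioo a b) :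
    (D.replaceChord a b h).toFun t = D.toFun t :=
  chordFun_of_notMem_Ioo h.lt ht

theorem replaceChord_proj_of_notMem (ht : t ∉ Ioo a b) :
    (D.replaceChord a b h).proj t = D.proj t :=
  congrArg Prod.fst (chordFun_of_notMem_Ioo h.lt ht)

theorem mem_crossingTimes_replaceChord :
    t ∈ (D.replaceChord a b h).crossingTimes ↔ t ∈ Ico (0 : ℝ) 1 ∧ t ∉ Icc a b ∧
      ∃ s ∈ Ico (0 : ℝ) 1, s ∉ Icc a b ∧ s ≠ t ∧ D.proj s = D.proj t :=
  h.mem_crossingTimesOf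

theorem crossingTimes_replaceChord_subset :
    (D.replaceChord a b h).crossingTimes ⊆ D.crossingTimes :=
  h.crossingTimesOf_subset

theorem toFun_of_mem_crossingTimes_replaceChord
    (ht : t ∈ (D.replaceChord a b h).crossingTimes) :
    (D.replaceChord a b h).toFun t = D.toFun t :=
  replaceChord_toFun_of_notMem h fun h' =>
    ((mem_crossingTimes_replaceChord h).mp ht).2.1 (Ioo_subset_Icc_self h')

theorem proj_eq_of_replaceChord_proj_eq (hs : s ∈ Ico (0 : ℝ) 1) (ht : t ∈ Ico (0 : ℝ) 1)
    (hne : s ≠ t) (hst : (D.replaceChord a b h).proj s = (D.replaceChord a b h).proj t) :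
    (D.replaceChord a b h).toFun s = D.toFun s ∧ (D.replaceChord a b h).toFun t = D.toFun t :=
  ⟨(h.of_proj_eq ht hs hne.symm hst.symm).2, (h.of_proj_eq hs ht hne hst).2⟩

theorem IsAscending.replaceChord (hD : D.IsAscending) : (D.replaceChord a b h).IsAscending := by
  intro s hs t ht hst hp
  obtain ⟨h1, h2⟩ := proj_eq_of_replaceChord_proj_eq h hs ht hst.ne hp
  unfold proj at hp
  rw [h1, h2] at hp ⊢
  exact hD s hs t ht hst hp

theorem IsDescending.replaceChord (hD : D.IsDescending) : (D.replaceChord a b h).IsDescending := by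
  intro s hs t ht hst hp
  obtain ⟨h1, h2⟩ := proj_eq_of_replaceChord_proj_eq h hs ht hst.ne hp
  unfold proj at hp
  rw [h1, h2] at hp ⊢
  exact hD s hs t ht hst hp

theorem signAt_replaceChord (ht : t ∈ (D.replaceChord a b h).crossingTimes) :
    (D.replaceChord a b h).signAt t = D.signAt t := by
  have hte := toFun_of_mem_crossingTimes_replaceChord h ht
  obtain ⟨ht0, htab, s₀, hs₀, hs₀ab, hne₀, hst₀⟩ := (mem_crossingTimes_replaceChord h).mp ht
  unfold signAt
  classical
  refine if_congr ⟨?_, ?_⟩ rfl rfl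
  · rintro ⟨s, hs, hne, hst, hlt⟩
    have h1 := (proj_eq_of_replaceChord_proj_eq h hs ht0 hne hst).1
    unfold proj at hst
    rw [h1, hte] at hst hlt
    exact ⟨s, hs, hne, hst, hlt⟩
  · rintro ⟨s, hs, hne, hst, hlt⟩
    -- The sign refers to some partner of `t` in the old diagram. As there are no triple points, it
    -- is the partner that survives the replacement.
    have : s = s₀ := by
      by_contra hss
      exact D.no_triple s hs s₀ hs₀ t ht0 hss hne hne₀ ⟨hst.trans hst₀.symm, hst₀⟩
    subst this
    have h1 := replaceChord_toFun_of_notMem h fun h' => hs₀ab (Ioo_subset_Icc_self h')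
    refine ⟨s, hs, hne, ?_, ?_⟩
    · unfold proj
      rw [h1, hte]
      exact hst
    · rwa [h1, hte]

theorem meetsOnly_replaceChord (ε : ℤˣ) : (D.replaceChord a b h).MeetsOnly ε a b := by
  intro t ht s hs hne hst
  have h1 := (h.of_proj_eq hs ⟨h.zero_lt.le.trans ht.1.le, ht.2.trans h.lt_one⟩ hne hst).1
  exact absurd (Ioo_subset_Icc_self ht) h1

end

/-! ### Local structure of a diagram -/

theorem exists_norm_ge {S : Set ℝ} (hS : IsClosed S) (hS1 : S ⊆ Icc 0 1) {u : ℂ}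
    (hu : ∀ t ∈ S, D.proj t ≠ u) : ∃ ρ > 0, ∀ t ∈ S, ρ ≤ ‖D.proj t - u‖ := by
  have hc : IsCompact S := isCompact_Icc.of_isClosed_subset hS hS1
  have hcont : ContinuousOn (fun t => ‖D.proj t - u‖) S :=
    ((D.continuousOn_proj.mono hS1).sub continuousOn_const).norm
  obtain ⟨ρ, hρ, h⟩ := hc.exists_forall_le' hcont (a := 0) fun t ht =>
    norm_pos_iff.mpr (sub_ne_zero.mpr (hu t ht))
  exact ⟨ρ, hρ, h⟩

/-- If two branches overlapped along an interval, or one were stationary in projection, there would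
be infinitely many crossing times. -/
theorem not_eventually_proj_eq (D : KnotDiagram) {s t α β : ℝ} (hs : s ∈ Ioo (0 : ℝ) 1)
    (ht : t ∈ Ioo (0 : ℝ) 1) (hα : α ≠ 0) (hne : s ≠ t ∨ α ≠ β) :
    ¬ ∀ᶠ x in 𝓝 (0 : ℝ), D.proj (s + α * x) = D.proj (t + β * x) := by
  intro h
  have hs' : ∀ᶠ x in 𝓝 (0 : ℝ), s + α * x ∈ Ioo (0 : ℝ) 1 :=
    ContinuousAt.eventually_mem (f := fun x => s + α * x) (by fun_prop)
      (Ioo_mem_nhds (by simpa using hs.1) (by simpa using hs.2))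
  have ht' : ∀ᶠ x in 𝓝 (0 : ℝ), t + β * x ∈ Ioo (0 : ℝ) 1 :=
    ContinuousAt.eventually_mem (f := fun x => t + β * x) (by fun_prop)
      (Ioo_mem_nhds (by simpa using ht.1) (by simpa using ht.2))
  have hne' : ∀ᶠ x in 𝓝[≠] (0 : ℝ), t + β * x ≠ s + α * x := by
    by_cases hst : s = t
    · filter_upwards [self_mem_nhdsWithin] with x hx hx'
      rw [hst, add_right_inj] at hx'
      exact (hne.resolve_left (not_not.mpr hst)) (mul_right_cancel₀ hx hx').symm
    · refine Filter.Eventually.filter_mono nhdsWithin_le_nhds ?_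
      have h1 : ContinuousAt (fun x : ℝ => t + β * x) 0 := by fun_prop
      have h2 : ContinuousAt (fun x : ℝ => s + α * x) 0 := by fun_prop
      exact h1.ne_iff_eventually_ne h2 |>.mp (by simpa using Ne.symm hst)
  have hev : ∀ᶠ x in 𝓝[≠] (0 : ℝ), s + α * x ∈ D.crossingTimes := by
    filter_upwards [hne', nhdsWithin_le_nhds hs', nhdsWithin_le_nhds ht', nhdsWithin_le_nhds h] with
      x h1 h2 h3 h4
    exact mem_crossingTimes_of_eq ⟨h3.1.le, h3.2⟩ ⟨h2.1.le, h2.2⟩ h1 h4.symm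
  have hfin : {x | s + α * x ∈ D.crossingTimes}.Finite :=
    D.finite_crossings.preimage fun x _ y _ hxy => mul_left_cancel₀ hα (add_left_cancel hxy)
  refine infinite_of_mem_nhds (0 : ℝ) (eventually_nhdsWithin_iff.mp hev)
    ((hfin.union (finite_singleton 0)).subset fun x hx => ?_)
  by_cases h0 : x = 0
  · exact Or.inr h0
  · exact Or.inl (hx h0)

end KnotDiagram

namespace KnotDiagram

variable {D : KnotDiagram} {a b s t : ℝ} {v w : Space}

theorem proj_eq_of_affine {x : ℝ} (h : D.toFun x = D.toFun t + (x - t) • v) :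
    D.proj x = D.proj t + (x - t) • v.1 :=
  congrArg Prod.fst h

theorem eventually_proj_add_mul (hv : ∀ᶠ x in 𝓝 t, D.toFun x = D.toFun t + (x - t) • v) (α : ℝ) :
    ∀ᶠ x in 𝓝 (0 : ℝ), D.proj (t + α * x) = D.proj t + x • α • v.1 := by
  have h1 : Filter.Tendsto (fun x : ℝ => t + α * x) (𝓝 0) (𝓝 t) := by
    have : ContinuousAt (fun x : ℝ => t + α * x) 0 := by fun_prop
    simpa [ContinuousAt] using this
  filter_upwards [h1.eventually hv] with x hx
  rw [proj_eq_of_affine hx, add_sub_cancel_left, smul_smul, mul_comm]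

theorem velocity_ne_zero (ht : t ∈ Ioo (0 : ℝ) 1)
    (hv : ∀ᶠ x in 𝓝 t, D.toFun x = D.toFun t + (x - t) • v) : v.1 ≠ 0 := by
  intro h0
  refine D.not_eventually_proj_eq (α := 1) (β := 0) ht ht one_ne_zero (Or.inr one_ne_zero) ?_
  filter_upwards [eventually_proj_add_mul hv 1] with x hx
  rw [hx]
  simp [h0]

theorem velocity_independent (hs : s ∈ Ioo (0 : ℝ) 1) (ht : t ∈ Ioo (0 : ℝ) 1) (hne : s ≠ t)
    (hst : D.proj s = D.proj t) (hv : ∀ᶠ x in 𝓝 s, D.toFun x = D.toFun s + (x - s) • v)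
    (hw : ∀ᶠ x in 𝓝 t, D.toFun x = D.toFun t + (x - t) • w) {α β : ℝ}
    (h : α • v.1 = β • w.1) : α = 0 ∧ β = 0 := by
  have hα : α = 0 := by
    by_contra hα
    refine D.not_eventually_proj_eq hs ht hα (Or.inl hne) (β := β) ?_
    filter_upwards [eventually_proj_add_mul hv α, eventually_proj_add_mul hw β] with x h1 h2
    rw [h1, h2, h, hst]
  refine ⟨hα, ?_⟩
  rw [hα, zero_smul, eq_comm, smul_eq_zero] at h
  exact h.resolve_right (velocity_ne_zero ht hw)

/-- Near `a` the knot is a straight segment that is not vertical. The rest of the knot has bounded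
height and, `a` not being a crossing, its projection stays away from that of `a`. -/
theorem boundedSlopeAt (ha : a ∈ Ioo (0 : ℝ) 1) (hac : a ∉ D.crossingTimes)
    (hD : AffineAt D.toFun a) : BoundedSlopeAt D.knot (D.toFun a) := by
  obtain ⟨v, hv⟩ := hD
  have hv0 := velocity_ne_zero ha hv
  obtain ⟨η, hη, hηv⟩ := Metric.eventually_nhds_iff.mp hv
  set S := Icc (0 : ℝ) 1 ∩ {x | η ≤ dist x a} with hS
  obtain ⟨ρ, hρ, hρS⟩ := exists_norm_ge (D := D) (S := S) (u := D.proj a)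
    (isClosed_Icc.inter (isClosed_le continuous_const (by fun_prop))) inter_subset_left
    (fun x hx => proj_ne_of_notMem_crossingTimes ha hac hx.1 fun h => by
      have := hx.2
      simp only [h, mem_ofPred_eq, dist_self] at this
      linarith)
  obtain ⟨Z, hZ⟩ := (isCompact_Icc (a := (0 : ℝ)) (b := 1)).exists_bound_of_continuousOn
    (D.continuousOn.snd.sub (continuousOn_const (c := (D.toFun a).2)))
  have hvn : 0 < ‖v.1‖ := norm_pos_iff.mpr hv0
  refine ⟨max (|v.2| / ‖v.1‖) (Z / ρ), ?_⟩
  rintro _ ⟨x, hx, rfl⟩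
  by_cases hxa : dist x a < η
  · rw [hηv hxa]
    have h1 : ((D.toFun a + (x - a) • v).2 - (D.toFun a).2) = (x - a) * v.2 := by simp
    have h2 : ((D.toFun a + (x - a) • v).1 - (D.toFun a).1) = (x - a) • v.1 := by simp
    rw [h1, h2, abs_mul, norm_smul, Real.norm_eq_abs]
    calc |x - a| * |v.2| = |v.2| / ‖v.1‖ * (|x - a| * ‖v.1‖) := by field_simp
      _ ≤ _ := by gcongr; exact le_max_left _ _
  · have h1 := hρS x ⟨hx, not_lt.mp hxa⟩
    have h2 := hZ x hx
    have hZ0 : 0 ≤ Z := (norm_nonneg _).trans h2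
    rw [Real.norm_eq_abs] at h2
    calc |(D.toFun x).2 - (D.toFun a).2| ≤ Z := h2
      _ = Z / ρ * ρ := by field_simp
      _ ≤ max (|v.2| / ‖v.1‖) (Z / ρ) * ‖(D.toFun x).1 - (D.toFun a).1‖ := by
        refine mul_le_mul (le_max_right _ _) h1 hρ.le ?_
        exact (div_nonneg hZ0 hρ.le).trans (le_max_right _ _)

theorem exists_affineAt (ha : 0 ≤ a) (hab : a < b) (hb : b ≤ 1) :
    ∃ m ∈ Ioo a b, AffineAt D.toFun m := by
  by_contra! h
  refine (Ioo_infinite hab) (D.polygonal.subset fun m hm => ?_)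
  exact ⟨⟨ha.trans_lt hm.1, hm.2.trans_le hb⟩, h m hm⟩

theorem MeetsOnly.mono {ε : ℤˣ} {a' b' : ℝ} (h : D.MeetsOnly ε a b) (ha : a ≤ a') (hb : b' ≤ b) :
    D.MeetsOnly ε a' b' :=
  fun t ht => h t ⟨ha.trans_lt ht.1, ht.2.trans_le hb⟩

theorem onSide_asymm {ε : ℤˣ} {x y : Space} (h : OnSide ε x y) : ¬ OnSide ε y x := by
  rcases Int.units_eq_one_or ε with rfl | rfl
  · rw [onSide_one] at h ⊢
    exact h.not_gt
  · rw [onSide_neg_one] at h ⊢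
    exact h.not_gt

theorem MeetsOnly.isPassingArc {ε : ℤˣ} {m : ℝ} (h : D.MeetsOnly ε a b) (ha : 0 < a) (hb : b < 1)
    (hac : a ∉ D.crossingTimes) (hbc : b ∉ D.crossingTimes) (hm : m ∈ Ioo a b)
    (hmD : AffineAt D.toFun m) :
    IsPassingArc ε (D.toFun '' (Icc 0 1 \ Ioo a b)) a m b D.toFun := by
  have hab : a < b := hm.1.trans hm.2
  have hsub : ∀ t ∈ Icc a b, t ∈ Ico (0 : ℝ) 1 := fun t ht =>
    ⟨ha.le.trans ht.1, ht.2.trans_lt hb⟩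
  have hIco : ∀ t ∈ Ioo a b, ∀ r ∈ D.toFun '' (Icc 0 1 \ Ioo a b), r.1 = (D.toFun t).1 →
      ∃ s ∈ Ico (0 : ℝ) 1, s ≠ t ∧ D.toFun s = r := by
    rintro t ht _ ⟨s, ⟨hs, hsab⟩, rfl⟩ hst
    obtain ⟨s', hs', hss', hor⟩ := exists_mem_Ico (D := D) hs
    refine ⟨s', hs', ?_, hss'⟩
    rintro rfl
    rcases hor with rfl | ⟨rfl, -⟩
    · exact hsab ht
    · exact ha.not_gt ht.1
  refine ⟨D.continuousOn.mono (Icc_subset_Icc ha.le hb.le), ?_, ?_, ?_, ?_⟩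
  -- A self-crossing of the arc would have each of its two points strictly on side `ε` of the other.
  · intro x hx y hy hxy
    by_contra hne
    have hxc : x ∈ D.crossingTimes :=
      mem_crossingTimes_of_eq (hsub y hy) (hsub x hx) (Ne.symm hne) hxy.symm
    have hyc : y ∈ D.crossingTimes := mem_crossingTimes_of_eq (hsub x hx) (hsub y hy) hne hxy
    have hio : ∀ z ∈ Icc a b, z ∈ D.crossingTimes → z ∈ Ioo a b := by
      intro z hz hzc
      rcases eq_endpoints_or_mem_Ioo_of_mem_Icc hz with rfl | rfl | h'
      · exact absurd hzc hac
      · exact absurd hzc hbc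
      · exact h'
    exact onSide_asymm (h x (hio x hx hxc) y (hsub y hy) (Ne.symm hne) hxy.symm)
      (h y (hio y hy hyc) x (hsub x hx) hne hxy)
  · intro t ht r hr hrt
    obtain ⟨s, hs, hne, rfl⟩ := hIco t ht r hr hrt
    exact h t ht s hs hne hrt
  · refine D.finite_crossings.subset ?_
    rintro t ⟨ht, r, hr, hrt⟩
    obtain ⟨s, hs, hne, rfl⟩ := hIco t ht r hr hrt
    exact mem_crossingTimes_of_eq hs (hsub t (Ioo_subset_Icc_self ht)) hne hrt
  · obtain ⟨v, hv, hv'⟩ := hmD.exists_hasDerivAt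
    exact ⟨v.1, velocity_ne_zero ⟨ha.trans hm.1, hm.2.trans hb⟩ hv', hv⟩

theorem IsReplaceable.isPassingArc {ε : ℤˣ} {m : ℝ} (h : D.IsReplaceable a b) (hm : m ∈ Ioo a b) :
    IsPassingArc ε (D.toFun '' (Icc 0 1 \ Ioo a b)) a m b (chordFun D.toFun a b) := by
  have hne : ∀ t ∈ Ioo a b, ∀ r ∈ D.toFun '' (Icc 0 1 \ Ioo a b),
      r.1 ≠ (chordFun D.toFun a b t).1 := by
    rintro t ht _ ⟨s, hs, rfl⟩ hst
    exact h.free t ht s hs hst.symm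
  refine ⟨continuousOn_chordFun, injOn_chordFun_fst h.lt h.proj_ne,
    fun t ht r hr hrt => absurd hrt (hne t ht r hr), ?_, ?_⟩
  · convert finite_empty
    ext t
    simp only [mem_ofPred_eq, mem_empty_iff_false, iff_false]
    rintro ⟨ht, r, hr, hrt⟩
    exact hne t ht r hr hrt
  · obtain ⟨v, hv, hv'⟩ := (affineAt_chordFun_of_mem (k := D.toFun) hm).exists_hasDerivAt
    exact ⟨v.1, velocity_ne_zero (D := D.replaceChord a b h)
      ⟨h.zero_lt.trans hm.1, hm.2.trans h.lt_one⟩ hv', hv⟩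

theorem isCompact_image_compl (D : KnotDiagram) (a b : ℝ) :
    IsCompact (D.toFun '' (Icc 0 1 \ Ioo a b)) :=
  (isCompact_Icc.diff isOpen_Ioo).image_of_continuousOn (D.continuousOn.mono sdiff_subset)

theorem IsReplaceable.arcIsotopic {ε : ℤˣ} (h : D.IsReplaceable a b) (hm : D.MeetsOnly ε a b)
    (ha : BoundedSlopeAt (D.toFun '' (Icc 0 1 \ Ioo a b)) (D.toFun a))
    (hb : BoundedSlopeAt (D.toFun '' (Icc 0 1 \ Ioo a b)) (D.toFun b)) :
    ArcIsotopic ε (D.toFun '' (Icc 0 1 \ Ioo a b)) a b D.toFun (D.replaceChord a b h).toFun := by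
  have h0 := h.zero_lt
  have h1 := h.lt_one
  obtain ⟨m, hmab, hmD⟩ := exists_affineAt (D := D) h0.le h.lt h1.le
  refine arcIsotopic_of_isPassingArc (D.isCompact_image_compl a b) hmab.1 hmab.2
    (hm.isPassingArc h0 h1 h.left h.right hmab hmD) (h.isPassingArc hmab) ?_ ?_ ha hb
    ⟨b, ⟨⟨(h0.trans h.lt).le, h1.le⟩, by simp⟩, rfl⟩
  · exact (replaceChord_toFun_of_notMem h (by simp)).symm
  · exact (replaceChord_toFun_of_notMem h (by simp)).symm

theorem IsReplaceable.exists_isotopy {ε : ℤˣ} (h : D.IsReplaceable a b) (hm : D.MeetsOnly ε a b)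
    (ha : BoundedSlopeAt (D.toFun '' (Icc 0 1 \ Ioo a b)) (D.toFun a))
    (hb : BoundedSlopeAt (D.toFun '' (Icc 0 1 \ Ioo a b)) (D.toFun b)) :
    ∃ H : unitInterval → (Space ≃ₜ Space), IsAmbientIsotopy H ∧
    (∀ t ∈ Icc (0 : ℝ) 1, H 1 (D.toFun t) = (D.replaceChord a b h).toFun t) ∧
    (∀ τ, ∀ t ∈ Icc (0 : ℝ) 1 \ Ioo a b, H τ (D.toFun t) = D.toFun t) ∧
    (∀ τ, ∀ t ∈ Ioo a b, ∀ s ∈ Icc (0 : ℝ) 1 \ Ioo a b,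
      (H τ (D.toFun t)).1 = D.proj s → OnSide ε (H τ (D.toFun t)) (D.toFun s)) := by
  obtain ⟨H, hH, hce, hR, hs⟩ := h.arcIsotopic hm ha hb
  refine ⟨H, hH, fun t ht => ?_, fun τ t ht => hR τ _ (mem_image_of_mem _ ht),
    fun τ t ht s hs' => hs τ t ht _ (mem_image_of_mem _ hs')⟩
  by_cases htab : t ∈ Ioo a b
  · exact hce t (Ioo_subset_Icc_self htab)
  · rw [hR 1 _ (mem_image_of_mem _ ⟨ht, htab⟩), replaceChord_toFun_of_notMem h htab]

theorem IsReplaceable.ambientIsotopic {ε : ℤˣ} (h : D.IsReplaceable a b) (hm : D.MeetsOnly ε a b)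
    (ha : BoundedSlopeAt (D.toFun '' (Icc 0 1 \ Ioo a b)) (D.toFun a))
    (hb : BoundedSlopeAt (D.toFun '' (Icc 0 1 \ Ioo a b)) (D.toFun b)) :
    AmbientIsotopic D.knot (D.replaceChord a b h).knot := by
  obtain ⟨H, hH, h1, -⟩ := h.exists_isotopy hm ha hb
  refine ⟨H, hH, ?_⟩
  rw [knot, knot, image_image]
  exact image_congr h1

theorem image_compl_subset_knot (D : KnotDiagram) (a b : ℝ) :
    D.toFun '' (Icc 0 1 \ Ioo a b) ⊆ D.knot :=
  image_mono sdiff_subset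

theorem IsReplaceable.isDetour {ε : ℤˣ} (h : D.IsReplaceable a b) (hm : D.MeetsOnly ε a b)
    (ha : AffineAt D.toFun a) (hb : AffineAt D.toFun b) :
    IsDetour ε a b D (D.replaceChord a b h) where
  zero_lt := h.zero_lt
  lt := h.lt
  lt_one := h.lt_one
  before := hm
  after := meetsOnly_replaceChord h ε
  isotopy := h.exists_isotopy hm
    ((boundedSlopeAt ⟨h.zero_lt, h.lt.trans h.lt_one⟩ h.left ha).mono
      (D.image_compl_subset_knot a b))
    ((boundedSlopeAt ⟨h.zero_lt.trans h.lt, h.lt_one⟩ h.right hb).mono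
      (D.image_compl_subset_knot a b))

/-! ### A disc around a crossing -/

/-- The crossing met at the times `s < t` is the centre of a round disc of radius `ρ` which the
diagram meets exactly in the two straight arcs with parameters in `[p, a]` and `[b, q]`. -/
structure IsCrossingDisc (D : KnotDiagram) (p s a b t q : ℝ) (v w : Space) (ρ : ℝ) : Prop where
  zero_lt : 0 < p
  lt_s : p < s
  s_lt : s < a
  lt : a < b
  lt_t : b < t
  t_lt : t < q
  lt_one : q < 1
  pos : 0 < ρ
  proj_eq : D.proj s = D.proj t
  left : ∀ x ∈ Icc p a, D.toFun x = D.toFun s + (x - s) • v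
  right : ∀ x ∈ Icc b q, D.toFun x = D.toFun t + (x - t) • w
  affine : ∀ x ∈ Icc p a ∪ Icc b q, AffineAt D.toFun x
  independent : ∀ α β : ℝ, α • v.1 = β • w.1 → α = 0 ∧ β = 0
  norm_p : (s - p) * ‖v.1‖ = ρ
  norm_a : (a - s) * ‖v.1‖ = ρ
  norm_b : (t - b) * ‖w.1‖ = ρ
  norm_q : (q - t) * ‖w.1‖ = ρ
  outside : ∀ x ∈ Icc (0 : ℝ) 1, x ∉ Icc p a → x ∉ Icc b q → ρ < ‖D.proj x - D.proj s‖

theorem exists_isCrossingDisc (hs : s ∈ Ioo (0 : ℝ) 1) (ht : t ∈ Ioo (0 : ℝ) 1) (hst : s < t)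
    (heq : D.proj s = D.proj t) :
    ∃ (p a b q : ℝ) (v w : Space) (ρ : ℝ), D.IsCrossingDisc p s a b t q v w ρ := by
  have hsI : s ∈ Ico (0 : ℝ) 1 := ⟨hs.1.le, hs.2⟩
  have htI : t ∈ Ico (0 : ℝ) 1 := ⟨ht.1.le, ht.2⟩
  have hsc : s ∈ D.crossingTimes := mem_crossingTimes_of_eq htI hsI hst.ne' heq.symm
  have htc : t ∈ D.crossingTimes := mem_crossingTimes_of_eq hsI htI hst.ne heq
  have hsA := (D.crossing_interior s hsc).2
  have htA := (D.crossing_interior t htc).2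
  obtain ⟨v, hv⟩ := id hsA
  obtain ⟨w, hw⟩ := id htA
  have hvA : ∀ᶠ x in 𝓝 s, AffineAt D.toFun x := by
    filter_upwards [hv.eventually_nhds] with x hx
    refine ⟨v, ?_⟩
    filter_upwards [hx] with y hy
    rw [hy, hx.self_of_nhds, add_assoc, ← add_smul]
    congr 2
    ring
  have hwA : ∀ᶠ x in 𝓝 t, AffineAt D.toFun x := by
    filter_upwards [hw.eventually_nhds] with x hx
    refine ⟨w, ?_⟩
    filter_upwards [hx] with y hy
    rw [hy, hx.self_of_nhds, add_assoc, ← add_smul]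
    congr 2
    ring
  obtain ⟨η₁, hη₁, hv'⟩ := Metric.eventually_nhds_iff.mp (hv.and hvA)
  obtain ⟨η₂, hη₂, hw'⟩ := Metric.eventually_nhds_iff.mp (hw.and hwA)
  -- `η` bounds the half-lengths of the parameter intervals: within it the curve is affine, the
  -- intervals stay in `(0, 1)`, and they are disjoint because `2 * η ≤ t - s`.
  obtain ⟨η, hη, hηle⟩ : ∃ η > 0, η ≤ η₁ ∧ η ≤ η₂ ∧ η ≤ s ∧ η ≤ 1 - t ∧ 2 * η ≤ t - s := by
    refine ⟨min (min η₁ η₂) (min (min s (1 - t)) ((t - s) / 2)), ?_, ?_, ?_, ?_, ?_, ?_⟩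
    · refine lt_min (lt_min hη₁ hη₂) (lt_min (lt_min hs.1 (by linarith [ht.2])) (by linarith))
    · exact (min_le_left _ _).trans (min_le_left _ _)
    · exact (min_le_left _ _).trans (min_le_right _ _)
    · exact (min_le_right _ _).trans ((min_le_left _ _).trans (min_le_left _ _))
    · exact (min_le_right _ _).trans ((min_le_left _ _).trans (min_le_right _ _))
    · have := (min_le_right (min η₁ η₂) (min (min s (1 - t)) ((t - s) / 2))).trans
        (min_le_right _ _)
      linarith
  obtain ⟨h1, h2, h3, h4, h5⟩ := hηle
  have hv0 := norm_pos_iff.mpr (velocity_ne_zero hs hv)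
  have hw0 := norm_pos_iff.mpr (velocity_ne_zero ht hw)
  obtain ⟨ρ₀, hρ₀, hρS⟩ := exists_norm_ge (D := D)
    (S := Icc (0 : ℝ) 1 ∩ {x | η ≤ |x - s|} ∩ {x | η ≤ |x - t|}) (u := D.proj s)
    ((isClosed_Icc.inter (isClosed_le continuous_const (by fun_prop))).inter
      (isClosed_le continuous_const (by fun_prop))) (fun x hx => hx.1.1) (by
      rintro x ⟨⟨hx, hxs⟩, hxt⟩ hxe
      simp only [mem_ofPred_eq] at hxs hxt
      obtain ⟨y, hy, hyx, hor⟩ := exists_mem_Ico (D := D) hx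
      have hye : D.proj y = D.proj s := (congrArg Prod.fst hyx).trans hxe
      have hys : y ≠ s := by
        rcases hor with rfl | ⟨rfl, rfl⟩
        · rintro rfl
          simp at hxs
          linarith
        · exact hs.1.ne
      have hyt : y ≠ t := by
        rcases hor with rfl | ⟨rfl, rfl⟩
        · rintro rfl
          simp at hxt
          linarith
        · exact ht.1.ne
      exact D.no_triple y hy s hsI t htI hys hyt hst.ne ⟨hye, heq⟩)
  -- Below `ρ₀`, so that parts of the curve away from both `s` and `t` stay outside the disc, and
  -- small enough that both diameters are traversed within `η`.
  set ρ := min (ρ₀ / 2) (min (η * ‖v.1‖ / 2) (η * ‖w.1‖ / 2)) with hρ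
  have hρpos : 0 < ρ := by positivity
  have hρv : ρ / ‖v.1‖ < η := by
    rw [div_lt_iff₀ hv0]
    have : ρ ≤ η * ‖v.1‖ / 2 := (min_le_right _ _).trans (min_le_left _ _)
    nlinarith
  have hρw : ρ / ‖w.1‖ < η := by
    rw [div_lt_iff₀ hw0]
    have : ρ ≤ η * ‖w.1‖ / 2 := (min_le_right _ _).trans (min_le_right _ _)
    nlinarith
  have hρρ : ρ < ρ₀ := by
    have : ρ ≤ ρ₀ / 2 := min_le_left _ _
    linarith
  have hpv : 0 < ρ / ‖v.1‖ := div_pos hρpos hv0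
  have hpw : 0 < ρ / ‖w.1‖ := div_pos hρpos hw0
  have hleft : ∀ x ∈ Icc (s - ρ / ‖v.1‖) (s + ρ / ‖v.1‖), dist x s < η₁ := by
    intro x hx
    rw [Real.dist_eq, abs_lt]
    constructor <;> linarith [hx.1, hx.2]
  have hright : ∀ x ∈ Icc (t - ρ / ‖w.1‖) (t + ρ / ‖w.1‖), dist x t < η₂ := by
    intro x hx
    rw [Real.dist_eq, abs_lt]
    constructor <;> linarith [hx.1, hx.2]
  refine ⟨s - ρ / ‖v.1‖, s + ρ / ‖v.1‖, t - ρ / ‖w.1‖, t + ρ / ‖w.1‖, v, w, ρ, ?_⟩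
  refine
    { zero_lt := by linarith
      lt_s := by linarith
      s_lt := by linarith
      lt := by linarith
      lt_t := by linarith
      t_lt := by linarith
      lt_one := by linarith
      pos := hρpos
      proj_eq := heq
      left := fun x hx => (hv' (hleft x hx)).1
      right := fun x hx => (hw' (hright x hx)).1
      affine := ?_
      independent := fun α β h => velocity_independent hs ht hst.ne heq hv hw h
      norm_p := by field_simp; ring
      norm_a := by field_simp; ring
      norm_b := by field_simp; ring
      norm_q := by field_simp; ring
      outside := ?_ }
  · rintro x (hx | hx)
    · exact (hv' (hleft x hx)).2
    · exact (hw' (hright x hx)).2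
  · intro x hx hxp hxq
    by_cases hxs : η ≤ |x - s|
    · by_cases hxt : η ≤ |x - t|
      · exact hρρ.trans_le (hρS x ⟨⟨hx, hxs⟩, hxt⟩)
      · rw [not_le] at hxt
        have hx1 := hw' (y := x) (by rw [Real.dist_eq]; linarith)
        rw [heq, proj_eq_of_affine hx1.1, add_sub_cancel_left, norm_smul, Real.norm_eq_abs,
          ← div_lt_iff₀ hw0, lt_abs]
        by_contra! hcon
        exact hxq ⟨by linarith [hcon.2], by linarith [hcon.1]⟩
    · rw [not_le] at hxs
      have hx1 := hv' (y := x) (by rw [Real.dist_eq]; linarith)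
      rw [proj_eq_of_affine hx1.1, add_sub_cancel_left, norm_smul, Real.norm_eq_abs,
        ← div_lt_iff₀ hv0, lt_abs]
      by_contra! hcon
      exact hxp ⟨by linarith [hcon.2], by linarith [hcon.1]⟩

end KnotDiagram

/-! ### Sorted lists -/

theorem sort_eq_of_pairwise {S : Finset ℝ} {l : List ℝ} (hl : l.Pairwise (· < ·))
    (hmem : ∀ x, x ∈ l ↔ x ∈ S) : S.sort (· ≤ ·) = l := by
  have hS : l.toFinset = S := by
    ext x
    simp [hmem]
  subst hS
  exact (List.toFinset_sort (· ≤ ·) (hl.imp fun h => h.ne)).mpr (hl.imp fun h => h.le)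

theorem pairwise_lt_sort (S : Finset ℝ) : (S.sort (· ≤ ·)).Pairwise (· < ·) :=
  (Finset.sortedLT_sort S).pairwise

theorem sort_eq_append_cons {S : Finset ℝ} {s : ℝ} (hs : s ∈ S) :
    S.sort (· ≤ ·) = (S.filter (· < s)).sort (· ≤ ·) ++ s :: (S.filter (s < ·)).sort (· ≤ ·) := by
  apply sort_eq_of_pairwise
  · rw [List.pairwise_append, List.pairwise_cons]
    refine ⟨pairwise_lt_sort _, ⟨fun x hx => by simpa using (Finset.mem_filter.mp
      ((Finset.mem_sort _).mp hx)).2, pairwise_lt_sort _⟩, fun x hx y hy => ?_⟩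
    have hx' : x < s := (Finset.mem_filter.mp ((Finset.mem_sort _).mp hx)).2
    rcases List.mem_cons.mp hy with rfl | hy
    · exact hx'
    · exact hx'.trans (Finset.mem_filter.mp ((Finset.mem_sort _).mp hy)).2
  · intro x
    simp only [List.mem_append, List.mem_cons, Finset.mem_sort, Finset.mem_filter]
    constructor
    · rintro (h | rfl | h)
      · exact h.1
      · exact hs
      · exact h.1
    · intro hx
      rcases lt_trichotomy x s with h | h | h
      · exact Or.inl ⟨hx, h⟩
      · exact Or.inr (Or.inl h)
      · exact Or.inr (Or.inr ⟨hx, h⟩)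

/-! ### Moves inside a crossing disc -/

namespace KnotDiagram

variable {D : KnotDiagram} {p s a b t q : ℝ} {v w : Space} {ρ : ℝ}

namespace IsCrossingDisc

section

variable (h : D.IsCrossingDisc p s a b t q v w ρ)
include h

theorem mem_Ico {x : ℝ} (hx : x ∈ Icc p q) : x ∈ Ico (0 : ℝ) 1 :=
  ⟨h.zero_lt.le.trans hx.1, hx.2.trans_lt h.lt_one⟩

theorem mem_Icc_left {x : ℝ} (hx : x ∈ Icc p a) : x ∈ Icc p q :=
  ⟨hx.1, by linarith [hx.2, h.lt, h.lt_t, h.t_lt]⟩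

theorem mem_Icc_right {x : ℝ} (hx : x ∈ Icc b q) : x ∈ Icc p q :=
  ⟨by linarith [hx.1, h.lt, h.lt_s, h.s_lt], hx.2⟩

theorem proj_left {x : ℝ} (hx : x ∈ Icc p a) : D.proj x = D.proj s + (x - s) • v.1 :=
  proj_eq_of_affine (h.left x hx)

theorem proj_right {x : ℝ} (hx : x ∈ Icc b q) : D.proj x = D.proj s + (x - t) • w.1 := by
  rw [h.proj_eq]
  exact proj_eq_of_affine (h.right x hx)

theorem norm_left {x : ℝ} (hx : x ∈ Icc p a) : ‖(x - s) • v.1‖ ≤ ρ := by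
  have h1 : |x - s| ≤ s - p := by
    have : (s - p) * ‖v.1‖ = (a - s) * ‖v.1‖ := h.norm_p.trans h.norm_a.symm
    have hv : ‖v.1‖ ≠ 0 := fun h0 => by
      have := h.norm_p
      rw [h0, mul_zero] at this
      exact h.pos.ne this
    have := mul_right_cancel₀ hv this
    rw [abs_le]
    constructor <;> linarith [hx.1, hx.2]
  rw [norm_smul, Real.norm_eq_abs, ← h.norm_p]
  gcongr

theorem norm_right {x : ℝ} (hx : x ∈ Icc b q) : ‖(x - t) • w.1‖ ≤ ρ := by
  have h1 : |x - t| ≤ t - b := by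
    have : (t - b) * ‖w.1‖ = (q - t) * ‖w.1‖ := h.norm_b.trans h.norm_q.symm
    have hw : ‖w.1‖ ≠ 0 := fun h0 => by
      have := h.norm_b
      rw [h0, mul_zero] at this
      exact h.pos.ne this
    have := mul_right_cancel₀ hw this
    rw [abs_le]
    constructor <;> linarith [hx.1, hx.2]
  rw [norm_smul, Real.norm_eq_abs, ← h.norm_b]
  gcongr

theorem eq_zero_of_add_eq {α β γ δ : ℝ} (he : α • v.1 + β • w.1 = γ • v.1 + δ • w.1) :
    α = γ ∧ β = δ := by
  have := h.independent (α - γ) (δ - β) (by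
    rw [sub_smul, sub_smul, sub_eq_sub_iff_add_eq_add, he, add_comm])
  exact ⟨by linarith [this.1], by linarith [this.2]⟩

theorem mem_of_norm_le {x : ℝ} (hx : x ∈ Icc (0 : ℝ) 1) (hn : ‖D.proj x - D.proj s‖ ≤ ρ) :
    x ∈ Icc p a ∨ x ∈ Icc b q := by
  by_contra! hcon
  exact (h.outside x hx hcon.1 hcon.2).not_ge hn

theorem eq_of_left_of_mem_crossingTimes {x : ℝ} (hx : x ∈ Icc p a) (hxc : x ∈ D.crossingTimes) :
    x = s := by
  obtain ⟨-, y, hy, hyx, hyx'⟩ := hxc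
  replace hyx' : D.proj y = D.proj x := hyx'
  have hxp := h.proj_left hx
  have hyn : ‖D.proj y - D.proj s‖ ≤ ρ := by
    rw [hyx', hxp, add_sub_cancel_left]
    exact h.norm_left hx
  rcases h.mem_of_norm_le ⟨hy.1, hy.2.le⟩ hyn with hy' | hy'
  · rw [hxp, h.proj_left hy', add_right_inj] at hyx'
    have := (h.eq_zero_of_add_eq (α := y - s) (β := 0) (γ := x - s) (δ := 0)
      (by simpa using hyx')).1
    exact absurd (by linarith) hyx
  · rw [hxp, h.proj_right hy', add_right_inj] at hyx'
    have := (h.eq_zero_of_add_eq (α := x - s) (β := 0) (γ := 0) (δ := y - t)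
      (by simpa using hyx'.symm)).1
    linarith

theorem eq_of_right_of_mem_crossingTimes {x : ℝ} (hx : x ∈ Icc b q) (hxc : x ∈ D.crossingTimes) :
    x = t := by
  obtain ⟨-, y, hy, hyx, hyx'⟩ := hxc
  replace hyx' : D.proj y = D.proj x := hyx'
  have hxp := h.proj_right hx
  have hyn : ‖D.proj y - D.proj s‖ ≤ ρ := by
    rw [hyx', hxp, add_sub_cancel_left]
    exact h.norm_right hx
  rcases h.mem_of_norm_le ⟨hy.1, hy.2.le⟩ hyn with hy' | hy'
  · rw [hxp, h.proj_left hy', add_right_inj] at hyx'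
    have := (h.eq_zero_of_add_eq (α := y - s) (β := 0) (γ := 0) (δ := x - t)
      (by simpa using hyx')).2
    linarith
  · rw [hxp, h.proj_right hy', add_right_inj] at hyx'
    have := (h.eq_zero_of_add_eq (α := 0) (β := y - t) (γ := 0) (δ := x - t)
      (by simpa using hyx')).2
    exact absurd (by linarith) hyx

theorem chordFun_fst {x y z : ℝ} (hx : x ∈ Icc p a) (hy : y ∈ Icc b q) (hz : z ∈ Icc x y) :
    (chordFun D.toFun x y z).1 = D.proj s + ((1 - (z - x) / (y - x)) * (x - s)) • v.1 +
      ((z - x) / (y - x) * (y - t)) • w.1 := by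
  rw [chordFun_fst_of_mem hz]
  have h1 : (D.toFun x).1 = _ := h.proj_left hx
  have h2 : (D.toFun y).1 = _ := h.proj_right hy
  rw [h1, h2]
  module

theorem norm_chordFun_le {x y z : ℝ} (hx : x ∈ Icc p a) (hy : y ∈ Icc b q) (hz : z ∈ Icc x y) :
    ‖(chordFun D.toFun x y z).1 - D.proj s‖ ≤ ρ := by
  have hxy : 0 < y - x := by linarith [hx.2, hy.1, h.lt]
  rw [h.chordFun_fst hx hy hz, add_assoc, add_sub_cancel_left, mul_smul, mul_smul]
  have h1 := h.norm_left hx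
  have h2 := h.norm_right hy
  set σ := (z - x) / (y - x)
  have hσ0 : 0 ≤ σ := div_nonneg (by linarith [hz.1]) hxy.le
  have hσ1 : σ ≤ 1 := (div_le_one hxy).mpr (by linarith [hz.2])
  refine (norm_add_le _ _).trans ?_
  rw [norm_smul (1 - σ), norm_smul σ, Real.norm_of_nonneg hσ0,
    Real.norm_of_nonneg (by linarith : 0 ≤ 1 - σ)]
  nlinarith

/-- By convexity the chord lies in the disc, where only the two diameters could obstruct it. In the
basis given by `v.1` and `w.1` its interior points have both coordinates nonzero, whereas on each
diameter one coordinate vanishes. -/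
theorem isReplaceable {x y : ℝ} (hx : x ∈ Icc p a) (hy : y ∈ Icc b q) (hxs : x ≠ s) (hyt : y ≠ t) :
    D.IsReplaceable x y where
  zero_lt := h.zero_lt.trans_le hx.1
  lt := by linarith [hx.2, hy.1, h.lt]
  lt_one := hy.2.trans_lt h.lt_one
  left hc := hxs (h.eq_of_left_of_mem_crossingTimes hx hc)
  right hc := hyt (h.eq_of_right_of_mem_crossingTimes hy hc)
  free := by
    intro z hz x' hx' heq
    have hxy : 0 < y - x := by linarith [hx.2, hy.1, h.lt]
    have hσ0 : (z - x) / (y - x) ≠ 0 := (div_pos (by linarith [hz.1]) hxy).ne'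
    have hσ1 : 1 - (z - x) / (y - x) ≠ 0 := by
      have : (z - x) / (y - x) < 1 := (div_lt_one hxy).mpr (by linarith [hz.2])
      linarith
    have hn := h.norm_chordFun_le hx hy (Ioo_subset_Icc_self hz)
    rw [heq] at hn
    rw [h.chordFun_fst hx hy (Ioo_subset_Icc_self hz), add_assoc] at heq
    rcases h.mem_of_norm_le hx'.1 hn with h1 | h1
    · rw [h.proj_left h1, add_right_inj] at heq
      have := (h.eq_zero_of_add_eq (γ := x' - s) (δ := 0)
        (heq.trans (by rw [zero_smul, add_zero]))).2
      exact mul_ne_zero hσ0 (sub_ne_zero.mpr hyt) this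
    · rw [h.proj_right h1, add_right_inj] at heq
      have := (h.eq_zero_of_add_eq (γ := 0) (δ := x' - t)
        (heq.trans (by rw [zero_smul, zero_add]))).1
      exact mul_ne_zero hσ1 (sub_ne_zero.mpr hxs) this

theorem isReplaceable_inner : D.IsReplaceable a b :=
  h.isReplaceable ⟨(h.lt_s.trans h.s_lt).le, le_rfl⟩ ⟨le_rfl, (h.lt_t.trans h.t_lt).le⟩ h.s_lt.ne'
    h.lt_t.ne

theorem isReplaceable_outer : D.IsReplaceable p q :=
  h.isReplaceable ⟨le_rfl, (h.lt_s.trans h.s_lt).le⟩ ⟨(h.lt_t.trans h.t_lt).le, le_rfl⟩ h.lt_s.ne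
    h.t_lt.ne'

theorem isReplaceable_mixed : D.IsReplaceable p b :=
  h.isReplaceable ⟨le_rfl, (h.lt_s.trans h.s_lt).le⟩ ⟨le_rfl, (h.lt_t.trans h.t_lt).le⟩ h.lt_s.ne
    h.lt_t.ne

theorem mem_crossingTimes_left : s ∈ D.crossingTimes :=
  mem_crossingTimes_of_eq (h.mem_Ico ⟨by linarith [h.lt_s, h.s_lt, h.lt, h.lt_t], h.t_lt.le⟩)
    (h.mem_Ico (h.mem_Icc_left ⟨h.lt_s.le, h.s_lt.le⟩))
    (by linarith [h.s_lt, h.lt, h.lt_t] : s < t).ne' h.proj_eq.symm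

theorem mem_crossingTimes_right : t ∈ D.crossingTimes :=
  mem_crossingTimes_of_eq (h.mem_Ico (h.mem_Icc_left ⟨h.lt_s.le, h.s_lt.le⟩))
    (h.mem_Ico (h.mem_Icc_right ⟨h.lt_t.le, h.t_lt.le⟩))
    (by linarith [h.s_lt, h.lt, h.lt_t] : s < t).ne h.proj_eq

/-- The segment between the outer ends works: it meets the diameters only in its endpoints, which
belong to the times `p < s` and `q > t` outside the loop. -/
theorem joinedIn_exterior : JoinedIn (D.proj '' Icc s t)ᶜ (D.proj p) (D.proj q) := by
  apply JoinedIn.of_segment_subset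
  rintro _ ⟨α, β, hα, hβ, hαβ, rfl⟩ ⟨z, hz, hzeq⟩
  have hp : p ∈ Icc p a := ⟨le_rfl, (h.lt_s.trans h.s_lt).le⟩
  have hq : q ∈ Icc b q := ⟨(h.lt_t.trans h.t_lt).le, le_rfl⟩
  have he : α • D.proj p + β • D.proj q =
      D.proj s + ((α * (p - s)) • v.1 + (β * (q - t)) • w.1) := by
    rw [h.proj_left hp, h.proj_right hq]
    have : α = 1 - β := by linarith
    subst this
    module
  rw [he] at hzeq
  have hn : ‖D.proj z - D.proj s‖ ≤ ρ := by
    rw [hzeq, add_sub_cancel_left, mul_smul, mul_smul]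
    refine (norm_add_le _ _).trans ?_
    rw [norm_smul α, norm_smul β, Real.norm_of_nonneg hα, Real.norm_of_nonneg hβ]
    have hnp := mul_le_mul_of_nonneg_left (h.norm_left hp) hα
    have hnq := mul_le_mul_of_nonneg_left (h.norm_right hq) hβ
    have : α * ρ + β * ρ = ρ := by rw [← add_mul, hαβ, one_mul]
    linarith
  have h1 := h.lt_s
  have h2 := h.t_lt
  have hz01 : z ∈ Icc (0 : ℝ) 1 := ⟨by linarith [h.zero_lt, hz.1], by linarith [h.lt_one, hz.2]⟩
  rcases h.mem_of_norm_le hz01 hn with hz' | hz'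
  · rw [h.proj_left hz', add_right_inj] at hzeq
    obtain ⟨h3, h4⟩ := h.eq_zero_of_add_eq (α := z - s) (β := 0)
      (Eq.trans (by rw [zero_smul, add_zero]) hzeq)
    have h5 : β = 0 := by
      rcases mul_eq_zero.mp h4.symm with h5 | h5
      · exact h5
      · linarith
    have h6 : α = 1 := by linarith
    rw [h6, one_mul] at h3
    linarith [hz.1]
  · rw [h.proj_right hz', add_right_inj] at hzeq
    obtain ⟨h3, h4⟩ := h.eq_zero_of_add_eq (α := 0) (β := z - t)
      (Eq.trans (by rw [zero_smul, zero_add]) hzeq)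
    have h5 : α = 0 := by
      rcases mul_eq_zero.mp h3.symm with h5 | h5
      · exact h5
      · linarith
    have h6 : β = 1 := by linarith
    rw [h6, one_mul] at h4
    linarith [hz.2]

theorem crossingTimes_inter_Icc_subset : D.crossingTimes ∩ Icc p q ⊆ Icc s t := by
  rintro x ⟨hxc, hx⟩
  constructor
  · by_contra! hlt
    exact hlt.ne (h.eq_of_left_of_mem_crossingTimes ⟨hx.1, by linarith [h.s_lt]⟩ hxc)
  · by_contra! hlt
    exact hlt.ne' (h.eq_of_right_of_mem_crossingTimes ⟨by linarith [h.lt_t], hx.2⟩ hxc)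

theorem crossingTimes_inter_Ioo_subset : D.crossingTimes ∩ Ioo s t ⊆ Ioo a b := by
  rintro x ⟨hxc, hx⟩
  constructor
  · by_contra! hle
    exact hx.1.ne' (h.eq_of_left_of_mem_crossingTimes ⟨by linarith [h.lt_s, hx.1], hle⟩ hxc)
  · by_contra! hle
    exact hx.2.ne (h.eq_of_right_of_mem_crossingTimes ⟨hle, by linarith [h.t_lt, hx.2]⟩ hxc)

theorem isLoop {ε : ℤˣ} (hfirst : ∀ x y, 0 ≤ x → x < y → y < t → D.proj x ≠ D.proj y)
    (hm : D.MeetsOnly ε 0 t) : IsLoop ε p s t q D where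
  zero_lt := h.zero_lt
  lt_left := h.lt_s
  lt := by linarith [h.s_lt, h.lt, h.lt_t]
  lt_right := h.t_lt
  lt_one := h.lt_one
  crossing := h.proj_eq
  only_self_crossing := by
    intro x hx y hy hxy he
    have hxI := h.mem_Ico hx
    have hyI := h.mem_Ico hy
    have hyc : y ∈ D.crossingTimes := mem_crossingTimes_of_eq hxI hyI hxy.ne he
    have hyt : y = t := by
      rcases lt_or_ge y t with h1 | h1
      · exact absurd he (hfirst x y hxI.1 hxy h1)
      · exact h.eq_of_right_of_mem_crossingTimes ⟨h.lt_t.le.trans h1, hy.2⟩ hyc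
    refine ⟨?_, hyt⟩
    by_contra hxs
    subst hyt
    exact D.no_triple x hxI s h.mem_crossingTimes_left.1 y hyI hxs hxy.ne
      (by linarith [h.s_lt, h.lt, h.lt_t] : s < y).ne ⟨he.trans h.proj_eq.symm, h.proj_eq⟩
  free_ends := fun _ hx => h.crossingTimes_inter_Icc_subset hx
  meetsOnly := hm.mono (h.zero_lt.trans h.lt_s).le le_rfl
  exterior := h.joinedIn_exterior

theorem isTangleDetour {ε : ℤˣ} (hm : D.MeetsOnly ε 0 t) :
    IsTangleDetour ε (D.crossingTimes ∩ Ioo s t).ncard 0 a b D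
      (D.replaceChord a b h.isReplaceable_inner) where
  detour := h.isReplaceable_inner.isDetour
    (hm.mono (by linarith [h.zero_lt, h.lt_s, h.s_lt]) h.lt_t.le)
    (h.affine a (Or.inl ⟨(h.lt_s.trans h.s_lt).le, le_rfl⟩))
    (h.affine b (Or.inr ⟨le_rfl, (h.lt_t.trans h.t_lt).le⟩))
  ends := ⟨h.isReplaceable_inner.left, h.isReplaceable_inner.right,
    fun h' => h.isReplaceable_inner.left (crossingTimes_replaceChord_subset _ h'),
    fun h' => h.isReplaceable_inner.right (crossingTimes_replaceChord_subset _ h')⟩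
  -- The new arc lies in the closed disc, the interior of the old one strictly outside it.
  disjoint := by
    intro x hx y hy he
    have ha : a ∈ Icc p a := ⟨(h.lt_s.trans h.s_lt).le, le_rfl⟩
    have hb : b ∈ Icc b q := ⟨le_rfl, (h.lt_t.trans h.t_lt).le⟩
    have hn : ‖D.proj x - D.proj s‖ ≤ ρ := by
      rw [he]
      exact h.norm_chordFun_le ha hb (Ioo_subset_Icc_self hy)
    have hx01 : x ∈ Icc (0 : ℝ) 1 := by
      have := h.mem_Ico (h.mem_Icc_left ha)
      have := h.mem_Ico (h.mem_Icc_right hb)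
      exact ⟨by linarith [hx.1, this.1, h.zero_lt, h.lt_s, h.s_lt], by linarith [hx.2, this.2]⟩
    rcases h.mem_of_norm_le hx01 hn with h1 | h1
    · exact hx.1.not_ge h1.2
    · exact hx.2.not_ge h1.1
  card_before := by
    congr 1
    ext x
    constructor
    · rintro ⟨hxc, hx⟩
      exact ⟨hxc, h.s_lt.trans hx.1, hx.2.trans h.lt_t⟩
    · rintro ⟨hxc, hx⟩
      exact ⟨hxc, h.crossingTimes_inter_Ioo_subset ⟨hxc, hx⟩⟩
  card_after := by
    convert ncard_empty ℝ
    ext x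
    simp only [mem_inter_iff, mem_empty_iff_false, iff_false]
    rintro ⟨hxc, hx⟩
    exact ((mem_crossingTimes_replaceChord _).mp hxc).2.1 (Ioo_subset_Icc_self hx)

/-- The crossing disc itself serves as the disc of the move: after the detour the whole arc from `p`
to `q` lies in it, and the rest of the diagram reaches at most its boundary, at `p` and `q`. -/
theorem isReidemeisterI : IsReidemeisterI s t (D.replaceChord a b h.isReplaceable_inner)
    (D.replaceChord p q h.isReplaceable_outer) := by
  have h1 := h.lt_s
  have h2 := h.s_lt
  have h3 := h.lt
  have h4 := h.lt_t
  have h5 := h.t_lt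
  have hs : s ∉ Icc a b := fun h' => h2.not_ge h'.1
  have ht : t ∉ Icc a b := fun h' => h4.not_ge h'.2
  have hsI := h.mem_crossingTimes_left.1
  have htI := h.mem_crossingTimes_right.1
  have hst : s < t := by linarith
  refine ⟨p, q, h.zero_lt, h1, hst, h5, h.lt_one, ?_, ?_, ?_, ?_, ?_⟩
  · rw [replaceChord_proj_of_notMem _ fun h' => hs (Ioo_subset_Icc_self h'),
      replaceChord_proj_of_notMem _ fun h' => ht (Ioo_subset_Icc_self h'), h.proj_eq]
  · ext x
    simp only [mem_inter_iff, mem_insert_iff, mem_singleton_iff]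
    constructor
    · rintro ⟨hxc, hx⟩
      have hxD := crossingTimes_replaceChord_subset _ hxc
      have hxab := ((mem_crossingTimes_replaceChord _).mp hxc).2.1
      by_cases hxa : x < a
      · exact Or.inl (h.eq_of_left_of_mem_crossingTimes ⟨hx.1, hxa.le⟩ hxD)
      · have : b < x := by
          by_contra! hxb
          exact hxab ⟨not_lt.mp hxa, hxb⟩
        exact Or.inr (h.eq_of_right_of_mem_crossingTimes ⟨this.le, hx.2⟩ hxD)
    · rintro (rfl | rfl)
      · exact ⟨(mem_crossingTimes_replaceChord _).mpr
          ⟨hsI, hs, t, htI, ht, hst.ne', h.proj_eq.symm⟩, h1.le, by linarith⟩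
      · exact ⟨(mem_crossingTimes_replaceChord _).mpr
          ⟨htI, ht, s, hsI, hs, hst.ne, h.proj_eq⟩, by linarith, h5.le⟩
  · ext x
    simp only [mem_inter_iff, mem_empty_iff_false, iff_false]
    rintro ⟨hxc, hx⟩
    exact ((mem_crossingTimes_replaceChord _).mp hxc).2.1 hx
  · intro x hx
    rw [replaceChord_toFun_of_notMem _ hx.2, replaceChord_toFun_of_notMem _ fun h' => hx.2
      ⟨by linarith [h'.1], by linarith [h'.2]⟩]
  · have hρ : (ρ : ℂ) ≠ 0 := Complex.ofReal_ne_zero.mpr h.pos.ne'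
    refine ⟨(Homeomorph.mulLeft₀ (ρ : ℂ) hρ).trans (Homeomorph.addLeft (D.proj s)), ?_, ?_⟩
    · have hmem : ∀ z : ℂ, ‖z - D.proj s‖ ≤ ρ →
          z ∈ ((Homeomorph.mulLeft₀ (ρ : ℂ) hρ).trans (Homeomorph.addLeft (D.proj s))) ''
            Metric.closedBall 0 1 := by
        intro z hz
        refine ⟨(ρ : ℂ)⁻¹ * (z - D.proj s), ?_, ?_⟩
        · rw [mem_closedBall_zero_iff, norm_mul, norm_inv, Complex.norm_of_nonneg h.pos.le,
            inv_mul_le_one₀ h.pos]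
          exact hz
        · simp [hρ]
      intro x hx
      have hp : p ∈ Icc p a := ⟨le_rfl, by linarith⟩
      have hq : q ∈ Icc b q := ⟨by linarith, le_rfl⟩
      refine ⟨hmem _ ?_, hmem _ (h.norm_chordFun_le hp hq hx)⟩
      by_cases hxab : x ∈ Ioo a b
      · exact h.norm_chordFun_le ⟨by linarith, le_rfl⟩ ⟨le_rfl, by linarith⟩
          (Ioo_subset_Icc_self hxab)
      · rw [replaceChord_proj_of_notMem _ hxab]
        by_cases hxa : x ≤ a
        · rw [h.proj_left ⟨hx.1, hxa⟩, add_sub_cancel_left]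
          exact h.norm_left ⟨hx.1, hxa⟩
        · have : b ≤ x := by
            by_contra! hxb
            exact hxab ⟨not_le.mp hxa, hxb⟩
          rw [h.proj_right ⟨this, hx.2⟩, add_sub_cancel_left]
          exact h.norm_right ⟨this, hx.2⟩
    · rintro x hx ⟨z, hz, hzx⟩
      have hxab : x ∉ Ioo a b := fun h' => hx.2 ⟨by linarith [h'.1], by linarith [h'.2]⟩
      rw [replaceChord_proj_of_notMem _ hxab] at hzx
      have hlt : ‖D.proj x - D.proj s‖ < ρ := by
        rw [← hzx]
        rw [mem_ball_zero_iff] at hz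
        simp only [Homeomorph.trans_apply, Homeomorph.coe_mulLeft₀, Homeomorph.coe_addLeft,
          add_sub_cancel_left, norm_mul, Complex.norm_of_nonneg h.pos.le]
        nlinarith [h.pos]
      rcases h.mem_of_norm_le hx.1 hlt.le with h' | h'
      · have : x = p := by
          by_contra hne
          exact hx.2 ⟨lt_of_le_of_ne h'.1 (Ne.symm hne), by linarith [h'.2]⟩
        rw [this, h.proj_left ⟨le_rfl, by linarith⟩, add_sub_cancel_left, norm_smul, Real.norm_eq_abs,
          abs_of_neg (by linarith), neg_sub, h.norm_p] at hlt
        exact lt_irrefl _ hlt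
      · have : x = q := by
          by_contra hne
          exact hx.2 ⟨by linarith [h'.1], lt_of_le_of_ne h'.2 hne⟩
        rw [this, h.proj_right ⟨by linarith, le_rfl⟩, add_sub_cancel_left, norm_smul,
          Real.norm_eq_abs, abs_of_pos (by linarith), h.norm_q] at hlt
        exact lt_irrefl _ hlt

theorem isLoopDetour {ε : ℤˣ} (hfirst : ∀ x y, 0 ≤ x → x < y → y < t → D.proj x ≠ D.proj y)
    (hm : D.MeetsOnly ε 0 t) :
    IsLoopDetour ε s t D (D.replaceChord p q h.isReplaceable_outer) :=
  ⟨p, q, a, b, D.replaceChord a b h.isReplaceable_inner, h.isLoop hfirst hm, h.s_lt, h.lt_t,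
    h.crossingTimes_inter_Ioo_subset, h.isTangleDetour hm, h.isReidemeisterI⟩

/-- Removing the loop at a crossing does not change the knot type if the diagram meets only over-
or only undercrossings before it has run through the loop. -/
theorem ambientIsotopic {ε : ℤˣ} (hm : D.MeetsOnly ε 0 t) :
    AmbientIsotopic D.knot (D.replaceChord p q h.isReplaceable_outer).knot := by
  have h1 := h.lt_s
  have h2 := h.s_lt
  have h3 := h.lt
  have h4 := h.lt_t
  have h5 := h.t_lt
  have h6 := h.zero_lt
  have h7 := h.lt_one
  have hp : p ∈ Icc p a := ⟨le_rfl, by linarith⟩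
  have hb : b ∈ Icc b q := ⟨le_rfl, by linarith⟩
  have hq : q ∈ Icc b q := ⟨by linarith, le_rfl⟩
  have hpD : BoundedSlopeAt D.knot (D.toFun p) :=
    boundedSlopeAt ⟨h6, by linarith⟩ h.isReplaceable_outer.left (h.affine p (Or.inl hp))
  have hbD : BoundedSlopeAt D.knot (D.toFun b) :=
    boundedSlopeAt ⟨by linarith, by linarith⟩ h.isReplaceable_mixed.right (h.affine b (Or.inr hb))
  have hqD : BoundedSlopeAt D.knot (D.toFun q) :=
    boundedSlopeAt ⟨by linarith, h7⟩ h.isReplaceable_outer.right (h.affine q (Or.inr hq))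
  -- The arc on `[p, q]` crosses itself, so it cannot be slid to its chord at once. The subarc on
  -- `[p, b]` stops before the second passage at `t` and is simple; it is straightened first.
  set F := D.replaceChord p b h.isReplaceable_mixed with hF
  have hFD : ∀ x, x ∉ Ioo p q → F.toFun x = D.toFun x := fun x hx =>
    replaceChord_toFun_of_notMem _ fun h' => hx ⟨h'.1, h'.2.trans (by linarith)⟩
  have hchord : ∀ x, chordFun F.toFun p q x = chordFun D.toFun p q x := by
    intro x
    by_cases hx : x ∈ Icc p q
    · rw [chordFun_of_mem hx, chordFun_of_mem hx, hFD p (by simp), hFD q (by simp)]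
    · have hx' : x ∉ Ioo p q := fun h' => hx (Ioo_subset_Icc_self h')
      rw [chordFun_of_notMem_Ioo (by linarith) hx', chordFun_of_notMem_Ioo (by linarith) hx',
        hFD x hx']
  have hFr : F.IsReplaceable p q :=
    { zero_lt := h6
      lt := by linarith
      lt_one := h7
      left := fun h' => h.isReplaceable_outer.left (crossingTimes_replaceChord_subset _ h')
      right := fun h' => h.isReplaceable_outer.right (crossingTimes_replaceChord_subset _ h')
      free := fun x hx y hy he => by
        rw [hchord] at he
        refine h.isReplaceable_outer.free x hx y hy (he.trans ?_)
        exact congrArg Prod.fst (hFD y hy.2) }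
  -- The arc of `F` on `(p, q)` meets no crossings at all: the only candidate is `t`, and its
  -- partner `s` went away with the replaced arc.
  have hFm : F.MeetsOnly ε p q := by
    intro x hx y hy hne he
    have hxI := h.mem_Ico (Ioo_subset_Icc_self hx)
    have hxc : x ∈ F.crossingTimes := mem_crossingTimes_of_eq hy hxI hne he
    exfalso
    have hxD := crossingTimes_replaceChord_subset _ hxc
    obtain ⟨-, hxb, z, hz, hzb, hzx, hze⟩ := (mem_crossingTimes_replaceChord _).mp hxc
    have hbx : b ≤ x := by
      by_contra! hlt
      exact hxb ⟨hx.1.le, hlt.le⟩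
    have hxt := h.eq_of_right_of_mem_crossingTimes ⟨hbx, hx.2.le⟩ hxD
    subst hxt
    refine D.no_triple z hz s h.mem_crossingTimes_left.1 x hxI ?_ hzx (by linarith)
      ⟨hze.trans h.proj_eq.symm, h.proj_eq⟩
    rintro rfl
    exact hzb ⟨h1.le, by linarith⟩
  have himage : F.toFun '' (Icc 0 1 \ Ioo p q) ⊆ D.knot := by
    rintro _ ⟨x, hx, rfl⟩
    exact ⟨x, hx.1, (hFD x hx.2).symm⟩
  have step1 := h.isReplaceable_mixed.ambientIsotopic (hm.mono h6.le h4.le)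
    (hpD.mono (D.image_compl_subset_knot p b)) (hbD.mono (D.image_compl_subset_knot p b))
  have step2 := hFr.ambientIsotopic hFm
    (by rw [hFD p (by simp)]; exact hpD.mono himage)
    (by rw [hFD q (by simp)]; exact hqD.mono himage)
  have hknot : (F.replaceChord p q hFr).knot = (D.replaceChord p q h.isReplaceable_outer).knot :=
    image_congr fun x _ => hchord x
  rw [hknot] at step2
  exact step1.trans step2

end

end IsCrossingDisc

end KnotDiagram

/-! ### Crossings and Gauss code after the move -/

namespace KnotDiagram

variable {D : KnotDiagram} {p s a b t q : ℝ} {v w : Space} {ρ : ℝ} {ε : ℤˣ}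

theorem signAt_of_onSide {x y : ℝ} (hx : x ∈ Ico (0 : ℝ) 1) (hy : y ∈ Ico (0 : ℝ) 1) (hne : y ≠ x)
    (he : D.proj y = D.proj x) (h : OnSide ε (D.toFun x) (D.toFun y)) : D.signAt x = ε := by
  rcases Int.units_eq_one_or ε with rfl | rfl
  · exact if_pos ⟨y, hy, hne, he, onSide_one.mp h⟩
  · refine if_neg ?_
    rintro ⟨z, hz, hzx, hze, hlt⟩
    rw [onSide_neg_one] at h
    have : z ≠ y := by
      rintro rfl
      exact h.not_gt hlt
    exact D.no_triple z hz y hy x hx this hzx hne ⟨hze.trans he.symm, he⟩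

theorem onSide_neg {x y : Space} (h : OnSide ε x y) : OnSide (-ε) y x := by
  rcases Int.units_eq_one_or ε with rfl | rfl
  · rw [onSide_one] at h
    rwa [onSide_neg_one]
  · rw [onSide_neg_one] at h
    rwa [neg_neg, onSide_one]

theorem MeetsOnly.signAt_eq (hm : D.MeetsOnly ε a b) {x : ℝ} (hx : x ∈ Ioo a b)
    (hxc : x ∈ D.crossingTimes) : D.signAt x = ε := by
  obtain ⟨hxI, y, hy, hne, he⟩ := hxc
  exact signAt_of_onSide hxI hy hne he (hm x hx y hy hne he)

theorem crossings_finite (D : KnotDiagram) : D.crossings.Finite :=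
  D.finite_crossings.image _

namespace IsCrossingDisc

/-- A crossing survives exactly if neither of its passages lies on the loop. The parts of `[p, q]`
outside `[s, t]` contain no crossing times, so `[s, t]` may take the place of `[p, q]`. -/
theorem mem_crossingTimes_outer (h : D.IsCrossingDisc p s a b t q v w ρ) {x : ℝ} :
    x ∈ (D.replaceChord p q h.isReplaceable_outer).crossingTimes ↔
      x ∈ D.crossingTimes ∧ (x < s ∨ t < x) ∧
        ∀ y ∈ D.crossingTimes, s < y → y < t → D.proj y ≠ D.proj x := by
  have hs := h.mem_crossingTimes_left
  have ht := h.mem_crossingTimes_right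
  have hst : s < t := by linarith [h.s_lt, h.lt, h.lt_t]
  have h1 := h.lt_s
  have h2 := h.t_lt
  rw [mem_crossingTimes_replaceChord]
  constructor
  · rintro ⟨hx, hxpq, y, hy, hypq, hyx, he⟩
    refine ⟨mem_crossingTimes_of_eq hy hx hyx he, ?_, ?_⟩
    · by_contra! hcon
      exact hxpq ⟨h1.le.trans hcon.1, hcon.2.trans h2.le⟩
    · intro z hz hsz hzt hzx
      have hzpq : z ∈ Icc p q := ⟨(h1.trans hsz).le, (hzt.trans h2).le⟩
      refine D.no_triple z hz.1 y hy x hx ?_ ?_ hyx ⟨hzx.trans he.symm, he⟩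
      · rintro rfl
        exact hypq hzpq
      · rintro rfl
        exact hxpq hzpq
  · rintro ⟨hxc, hxst, hz⟩
    have hxpq : x ∉ Icc p q := fun hx => by
      have := h.crossingTimes_inter_Icc_subset ⟨hxc, hx⟩
      rcases hxst with h' | h'
      · exact h'.not_ge this.1
      · exact h'.not_ge this.2
    have hxs : x ≠ s := by
      rintro rfl
      rcases hxst with h' | h' <;> linarith
    have hxt : x ≠ t := by
      rintro rfl
      rcases hxst with h' | h' <;> linarith
    obtain ⟨hx, y, hy, hyx, he⟩ := id hxc
    have hyc : y ∈ D.crossingTimes := mem_crossingTimes_of_eq hx hy hyx.symm (Eq.symm he)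
    refine ⟨hx, hxpq, y, hy, fun hypq => ?_, hyx, he⟩
    have hyst := h.crossingTimes_inter_Icc_subset ⟨hyc, hypq⟩
    have hxps : D.proj x ≠ D.proj s := fun hps =>
      D.no_triple x hx s hs.1 t ht.1 hxs hxt hst.ne ⟨hps, h.proj_eq⟩
    rcases eq_endpoints_or_mem_Ioo_of_mem_Icc hyst with rfl | rfl | hy'
    · exact hxps (Eq.symm he)
    · exact hxps (Eq.trans (Eq.symm he) h.proj_eq.symm)
    · exact hz y hyc hy'.1 hy'.2 he

/-- No new crossings appear, and the crossing at `s` disappears: a surviving passage through it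
would make it a triple point. -/
theorem crossingNumber_lt (h : D.IsCrossingDisc p s a b t q v w ρ) :
    (D.replaceChord p q h.isReplaceable_outer).crossingNumber < D.crossingNumber := by
  refine ncard_lt_ncard ⟨?_, fun hsub => ?_⟩ D.crossings_finite
  · rintro _ ⟨x, hx, rfl⟩
    have : (D.replaceChord p q h.isReplaceable_outer).proj x = D.proj x :=
      congrArg Prod.fst (toFun_of_mem_crossingTimes_replaceChord _ hx)
    rw [this]
    exact ⟨x, (h.mem_crossingTimes_outer.mp hx).1, rfl⟩
  · obtain ⟨x, hx, he⟩ := hsub ⟨s, h.mem_crossingTimes_left, rfl⟩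
    have : (D.replaceChord p q h.isReplaceable_outer).proj x = D.proj x :=
      congrArg Prod.fst (toFun_of_mem_crossingTimes_replaceChord _ hx)
    rw [this] at he
    obtain ⟨hxc, hxst, -⟩ := h.mem_crossingTimes_outer.mp hx
    have hst : s < t := by linarith [h.s_lt, h.lt, h.lt_t]
    refine D.no_triple x hxc.1 s h.mem_crossingTimes_left.1 t h.mem_crossingTimes_right.1 ?_ ?_
      hst.ne ⟨he, h.proj_eq⟩
    · rintro rfl
      rcases hxst with h' | h' <;> linarith
    · rintro rfl
      rcases hxst with h' | h' <;> linarith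

theorem deletesBlock (h : D.IsCrossingDisc p s a b t q v w ρ)
    (hfirst : ∀ x y, 0 ≤ x → x < y → y < t → D.proj x ≠ D.proj y) (hm : D.MeetsOnly ε 0 t) :
    DeletesBlock ε (D.proj s) D.gaussCode
      (D.replaceChord p q h.isReplaceable_outer).gaussCode := by
  have hs := h.mem_crossingTimes_left
  have ht := h.mem_crossingTimes_right
  have hst : s < t := by linarith [h.s_lt, h.lt, h.lt_t]
  have hs0 : 0 < s := h.zero_lt.trans h.lt_s
  set S := D.finite_crossings.toFinset with hS
  have hSmem : ∀ x, x ∈ S ↔ x ∈ D.crossingTimes := fun x => Set.Finite.mem_toFinset _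
  set S₁ := S.filter (· < s) with hS₁
  set S₂ := (S.filter (s < ·)).filter (· < t) with hS₂
  set S₃ := (S.filter (s < ·)).filter (t < ·) with hS₃
  have hsort : S.sort (· ≤ ·) =
      S₁.sort (· ≤ ·) ++ s :: (S₂.sort (· ≤ ·) ++ t :: S₃.sort (· ≤ ·)) := by
    rw [sort_eq_append_cons ((hSmem s).mpr hs),
      sort_eq_append_cons (S := S.filter (s < ·)) (s := t)
        (Finset.mem_filter.mpr ⟨(hSmem t).mpr ht, hst⟩)]
  have mem₁ : ∀ x, x ∈ S₁.sort (· ≤ ·) ↔ x ∈ D.crossingTimes ∧ x < s := fun x => by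
    rw [Finset.mem_sort, Finset.mem_filter, hSmem]
  have mem₂ : ∀ x, x ∈ S₂.sort (· ≤ ·) ↔ x ∈ D.crossingTimes ∧ s < x ∧ x < t := fun x => by
    rw [Finset.mem_sort, Finset.mem_filter, Finset.mem_filter, hSmem, and_assoc]
  have mem₃ : ∀ x, x ∈ S₃.sort (· ≤ ·) ↔ x ∈ D.crossingTimes ∧ s < x ∧ t < x := fun x => by
    rw [Finset.mem_sort, Finset.mem_filter, Finset.mem_filter, hSmem, and_assoc]
  set f : ℝ → ℂ × ℤˣ := fun x => (D.proj x, D.signAt x) with hf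
  have hfs : f s = (D.proj s, ε) := by
    rw [hf]
    exact Prod.ext rfl (hm.signAt_eq ⟨hs0, hst⟩ hs)
  have hft : f t = (D.proj s, -ε) := by
    refine Prod.ext h.proj_eq.symm ?_
    exact signAt_of_onSide ht.1 hs.1 hst.ne h.proj_eq
      (onSide_neg (hm s ⟨hs0, hst⟩ t ht.1 hst.ne' h.proj_eq.symm))
  -- The crossing times before `s`, after `t` and strictly between supply the words `A` and `B` and
  -- the block `xs`. Minimality of `t` makes the labels of the block distinct and absent from `A`.
  refine ⟨(S₁.sort (· ≤ ·)).map f, (S₃.sort (· ≤ ·)).map f, (S₂.sort (· ≤ ·)).map D.proj,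
    ?_, ?_, ?_, ?_⟩
  · have h₂ : (S₂.sort (· ≤ ·)).map f =
        ((S₂.sort (· ≤ ·)).map D.proj).map fun x => (x, ε) := by
      rw [List.map_map]
      refine List.map_congr_left fun x hx => ?_
      obtain ⟨hxc, h1, h2⟩ := (mem₂ x).mp hx
      exact Prod.ext rfl (hm.signAt_eq ⟨hs0.trans h1, h2⟩ hxc)
    have : D.gaussCode = (S.sort (· ≤ ·)).map f := rfl
    rw [this, hsort]
    simp [hfs, hft, h₂]
  · have hpair : (s :: S₂.sort (· ≤ ·)).Pairwise (· < ·) :=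
      List.pairwise_cons.mpr ⟨fun x hx => ((mem₂ x).mp hx).2.1, pairwise_lt_sort _⟩
    have hmem : ∀ x ∈ s :: S₂.sort (· ≤ ·), s ≤ x ∧ x < t := by
      intro x hx
      rcases List.mem_cons.mp hx with rfl | hx
      · exact ⟨le_rfl, hst⟩
      · exact ⟨((mem₂ x).mp hx).2.1.le, ((mem₂ x).mp hx).2.2⟩
    have := List.Nodup.map_on (f := D.proj) (fun x hx y hy he => by
      obtain ⟨hx1, hx2⟩ := hmem x hx
      obtain ⟨hy1, hy2⟩ := hmem y hy
      rcases lt_trichotomy x y with hlt | hlt | hlt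
      · exact absurd he (hfirst x y (hs0.le.trans hx1) hlt hy2)
      · exact hlt
      · exact absurd he.symm (hfirst y x (hs0.le.trans hy1) hlt hx2))
      (hpair.imp fun h => h.ne)
    simpa using this
  · intro l hl hl'
    obtain ⟨x, hx, rfl⟩ := List.mem_map.mp hl
    obtain ⟨hxc, hxs⟩ := (mem₁ x).mp hx
    rcases List.mem_cons.mp hl' with h' | h'
    · exact hfirst x s hxc.1.1 hxs hst h'
    · obtain ⟨y, hy, hyx⟩ := List.mem_map.mp h'
      obtain ⟨-, h1, h2⟩ := (mem₂ y).mp hy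
      exact hfirst x y hxc.1.1 (hxs.trans h1) h2 hyx.symm
  · classical
    rw [← List.map_append, List.filter_map]
    set D' := D.replaceChord p q h.isReplaceable_outer with hD'
    have hsort' : D'.finite_crossings.toFinset.sort (· ≤ ·) =
        (S₁.sort (· ≤ ·) ++ S₃.sort (· ≤ ·)).filter
          fun x => D.proj x ∉ (S₂.sort (· ≤ ·)).map D.proj := by
      apply sort_eq_of_pairwise
      · refine List.Pairwise.filter _ (List.pairwise_append.mpr
          ⟨pairwise_lt_sort _, pairwise_lt_sort _, fun x hx y hy => ?_⟩)
        exact ((mem₁ x).mp hx).2.trans ((mem₃ y).mp hy).2.1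
      · intro x
        rw [List.mem_filter, List.mem_append, mem₁, mem₃, Set.Finite.mem_toFinset, decide_eq_true_eq]
        refine Iff.trans ?_ h.mem_crossingTimes_outer.symm
        have hxs : (D.proj x ∉ (S₂.sort (· ≤ ·)).map D.proj) ↔
            ∀ y ∈ D.crossingTimes, s < y → y < t → D.proj y ≠ D.proj x := by
          rw [List.mem_map]
          constructor
          · intro hn y hy h1 h2 he
            exact hn ⟨y, (mem₂ y).mpr ⟨hy, h1, h2⟩, he⟩
          · rintro hn ⟨y, hy, he⟩
            obtain ⟨hy, h1, h2⟩ := (mem₂ y).mp hy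
            exact hn y hy h1 h2 he
        rw [hxs]
        constructor
        · rintro ⟨h1 | h1, h2⟩
          · exact ⟨h1.1, Or.inl h1.2, h2⟩
          · exact ⟨h1.1, Or.inr h1.2.2, h2⟩
        · rintro ⟨h1, h2 | h2, h3⟩
          · exact ⟨Or.inl ⟨h1, h2⟩, h3⟩
          · exact ⟨Or.inr ⟨h1, hst.trans h2, h2⟩, h3⟩
    have hmap : D'.gaussCode = (D'.finite_crossings.toFinset.sort (· ≤ ·)).map f := by
      refine List.map_congr_left fun x hx => ?_
      rw [Finset.mem_sort, Set.Finite.mem_toFinset] at hx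
      have h1 : D'.proj x = D.proj x :=
        congrArg Prod.fst (toFun_of_mem_crossingTimes_replaceChord _ hx)
      have h2 : D'.signAt x = D.signAt x := signAt_replaceChord _ hx
      rw [h1, h2]
    rw [hmap, hsort']
    congr 1

end IsCrossingDisc

/-- `t` is the least of the finitely many times that are the later passage of a crossing; crossings
never lie at the starting point, whence `0 < s`. -/
theorem exists_first_closing (D : KnotDiagram) (hD : D.crossingTimes.Nonempty) :
    ∃ s t, s ∈ Ioo (0 : ℝ) 1 ∧ t ∈ Ioo (0 : ℝ) 1 ∧ s < t ∧ D.proj s = D.proj t ∧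
      ∀ x y, 0 ≤ x → x < y → y < t → D.proj x ≠ D.proj y := by
  set T := {t | t ∈ Ico (0 : ℝ) 1 ∧ ∃ s ∈ Ico (0 : ℝ) 1, s < t ∧ D.proj s = D.proj t} with hT
  have hTc : T ⊆ D.crossingTimes := by
    rintro t ⟨ht, s, hs, hlt, he⟩
    exact mem_crossingTimes_of_eq hs ht hlt.ne he
  have hTn : T.Nonempty := by
    obtain ⟨t, ht, s, hs, hne, he⟩ := hD
    rcases lt_or_gt_of_ne hne with h | h
    · exact ⟨t, ht, s, hs, h, he⟩
    · exact ⟨s, hs, t, ht, h, Eq.symm he⟩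
  obtain ⟨t, ⟨ht, s, hs, hst, he⟩, hmin⟩ :=
    Set.exists_min_image T id (D.finite_crossings.subset hTc) hTn
  have hsc : s ∈ D.crossingTimes := mem_crossingTimes_of_eq ht hs hst.ne' he.symm
  have hs0 : 0 < s := lt_of_le_of_ne hs.1 (D.crossing_interior s hsc).1.symm
  refine ⟨s, t, ⟨hs0, hs.2⟩, ⟨hs0.trans hst, ht.2⟩, hst, he, fun x y hx hxy hyt hp => ?_⟩
  have := hmin y ⟨⟨hx.trans hxy.le, hyt.trans ht.2⟩, x, ⟨hx, (hxy.trans hyt).trans ht.2⟩, hxy, hp⟩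
  exact this.not_gt hyt

theorem meetsOnly_of_first_closing
    (hD : (ε = -1 ∧ D.IsAscending) ∨ (ε = 1 ∧ D.IsDescending)) (ht : t ≤ 1)
    (hfirst : ∀ x y, 0 ≤ x → x < y → y < t → D.proj x ≠ D.proj y) : D.MeetsOnly ε 0 t := by
  intro x hx y hy hne he
  have hxy : x < y := by
    by_contra! hle
    exact hfirst y x hy.1 (lt_of_le_of_ne hle hne) hx.2 he
  have hxI : x ∈ Ico (0 : ℝ) 1 := ⟨hx.1.le, hx.2.trans_le ht⟩
  rcases hD with ⟨rfl, hD⟩ | ⟨rfl, hD⟩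
  · exact onSide_neg_one.mpr (hD x hxI y hy hxy he.symm)
  · exact onSide_one.mpr (hD x hxI y hy hxy he.symm)

theorem gaussCode_eq_nil (h : D.crossingTimes = ∅) : D.gaussCode = [] := by
  have : D.finite_crossings.toFinset = ∅ := by
    rw [Set.Finite.toFinset_eq_empty]
    exact h
  simp [gaussCode, this]

end KnotDiagram

/-! ### Diagrams without crossings -/

theorem AffineAt.eventually {k : ℝ → Space} {t : ℝ} (h : AffineAt k t) :
    ∃ V : Space, ∀ᶠ s in 𝓝 t, HasDerivAt k V s := by
  obtain ⟨V, hV⟩ := h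
  refine ⟨V, ?_⟩
  filter_upwards [hV.eventually_nhds] with s hs
  have h1 : HasDerivAt (fun x : ℝ => k t + (x - t) • V) V s := by
    simpa using (((hasDerivAt_id s).sub_const t).smul_const V).const_add (k t)
  exact h1.congr_of_eventuallyEq hs

/-- The derivative is locally constant, hence constant on the connected open interval; the formula
reaches the ends by continuity. -/
theorem exists_eq_add_smul_of_affineAt {k : ℝ → Space} {x y : ℝ} (hxy : x < y)
    (hk : ContinuousOn k (Icc x y)) (h : ∀ t ∈ Ioo x y, AffineAt k t) :
    ∃ V : Space, ∀ t ∈ Icc x y, k t = k x + (t - x) • V := by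
  have hderiv : ∀ t ∈ Ioo x y, HasDerivAt (deriv k) 0 t := by
    intro t ht
    obtain ⟨V, hV⟩ := (h t ht).eventually
    refine (hasDerivAt_const t V).congr_of_eventuallyEq ?_
    filter_upwards [hV] with s hs
    exact hs.deriv
  obtain ⟨V, hV⟩ := isOpen_Ioo.exists_is_const_of_deriv_eq_zero isPreconnected_Ioo
    (fun t ht => (hderiv t ht).differentiableAt.differentiableWithinAt)
    (fun t ht => (hderiv t ht).deriv)
  have hkV : ∀ t ∈ Ioo x y, HasDerivAt (fun s => k s - s • V) 0 t := by
    intro t ht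
    obtain ⟨V', hV'⟩ := (h t ht).eventually
    have h1 := hV'.self_of_nhds
    have h2 : V' = V := by rw [← h1.deriv, hV t ht]
    subst h2
    have h3 := h1.sub ((hasDerivAt_id t).smul_const V')
    rw [one_smul, sub_self] at h3
    exact h3
  obtain ⟨A, hA⟩ := isOpen_Ioo.exists_is_const_of_deriv_eq_zero isPreconnected_Ioo
    (fun t ht => (hkV t ht).differentiableAt.differentiableWithinAt)
    (fun t ht => (hkV t ht).deriv)
  have hEq : EqOn (fun s => k s - s • V) (fun _ => A) (Icc x y) := by
    refine Set.EqOn.of_subset_closure (s := Ioo x y) hA (hk.sub (by fun_prop)) continuousOn_const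
      Ioo_subset_Icc_self ?_
    rw [closure_Ioo hxy.ne]
  refine ⟨V, fun t ht => ?_⟩
  have h1 : k t - t • V = A := hEq ht
  have h2 : k x - x • V = A := hEq (left_mem_Icc.mpr hxy.le)
  rw [sub_smul, sub_eq_iff_eq_add.mp h1, sub_eq_iff_eq_add.mp h2]
  abel

/-- The affine embedding of the plane into space which maps the unit circle to an ellipse over a
round circle of the plane. -/
def ellipseMap (M W : ℂ) (h₀ h₁ : ℝ) (ζ : ℂ) : Space :=
  (M + W * ζ, h₀ + h₁ * ζ.re)

section

variable {M W : ℂ} {h₀ h₁ : ℝ}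

theorem continuous_ellipseMap : Continuous (ellipseMap M W h₀ h₁) := by
  unfold ellipseMap
  fun_prop

theorem ellipseMap_fst_inj (hW : W ≠ 0) {ζ ξ : ℂ} :
    (ellipseMap M W h₀ h₁ ζ).1 = (ellipseMap M W h₀ h₁ ξ).1 ↔ ζ = ξ := by
  simp [ellipseMap, hW]

theorem boundedSlopeAt_ellipseMap (hW : W ≠ 0) (S : Set ℂ) (ξ : ℂ) :
    BoundedSlopeAt (ellipseMap M W h₀ h₁ '' S) (ellipseMap M W h₀ h₁ ξ) := by
  refine ⟨|h₁| / ‖W‖, ?_⟩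
  rintro _ ⟨ζ, -, rfl⟩
  have hW' : 0 < ‖W‖ := norm_pos_iff.mpr hW
  have e1 : (ellipseMap M W h₀ h₁ ζ).2 - (ellipseMap M W h₀ h₁ ξ).2 = h₁ * (ζ - ξ).re := by
    simp [ellipseMap]
    ring
  have e2 : (ellipseMap M W h₀ h₁ ζ).1 - (ellipseMap M W h₀ h₁ ξ).1 = W * (ζ - ξ) := by
    simp [ellipseMap]
    ring
  rw [e1, e2, abs_mul, norm_mul]
  calc |h₁| * |(ζ - ξ).re| ≤ |h₁| * ‖ζ - ξ‖ := by gcongr; exact Complex.abs_re_le_norm _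
    _ = |h₁| / ‖W‖ * (‖W‖ * ‖ζ - ξ‖) := by field_simp

/-- A shear that levels the ellipse and a similarity that normalises its shadow are run
simultaneously; the factor `W⁻¹` is reached through its logarithm. -/
theorem isUnknot_ellipse (hW : W ≠ 0) :
    IsUnknot (ellipseMap M W h₀ h₁ '' {ζ | ‖ζ‖ = 1}) := by
  set l := Complex.log W⁻¹ with hl
  have hexp : Complex.exp l = W⁻¹ := Complex.exp_log (inv_ne_zero hW)
  obtain ⟨H, hH, hHf⟩ := exists_isAmbientIsotopy_of_inverse
    (fun x => (Complex.exp ((x.1 : ℝ) * l) * (x.2.1 - (x.1 : ℝ) * M),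
      x.2.2 - (x.1 : ℝ) * (h₀ + h₁ * ((x.2.1 - M) / W).re)))
    (fun x => (Complex.exp (-((x.1 : ℝ) * l)) * x.2.1 + (x.1 : ℝ) * M,
      x.2.2 + (x.1 : ℝ) *
        (h₀ + h₁ * ((Complex.exp (-((x.1 : ℝ) * l)) * x.2.1 + (x.1 : ℝ) * M - M) / W).re)))
    (by fun_prop) (by fun_prop)
    (by
      intro τ x
      have : Complex.exp (-((τ : ℝ) * l)) * (Complex.exp ((τ : ℝ) * l) * (x.1 - (τ : ℝ) * M)) +
          (τ : ℝ) * M = x.1 := by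
        rw [← mul_assoc, ← Complex.exp_add]
        simp
      simp only [this]
      simp)
    (by
      intro τ x
      have : Complex.exp ((τ : ℝ) * l) * (Complex.exp (-((τ : ℝ) * l)) * x.1) = x.1 := by
        rw [← mul_assoc, ← Complex.exp_add]
        simp
      simp [this])
    (by simp)
  have hH1 : ∀ ζ, H 1 (ellipseMap M W h₀ h₁ ζ) = (ζ, 0) := by
    intro ζ
    rw [hHf]
    simp [ellipseMap, hexp, hW]
  refine ⟨H, hH, ?_⟩
  rw [image_image]
  ext x
  constructor
  · rintro ⟨ζ, hζ, rfl⟩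
    simp only [hH1]
    exact ⟨hζ, rfl⟩
  · rintro ⟨hx1, hx2⟩
    exact ⟨x.1, hx1, by simp only [hH1]; exact Prod.ext rfl hx2.symm⟩

/-- An arc of the ellipse. -/
theorem isPassingArc_ellipseMap {ε : ℤˣ} (hW : W ≠ 0) {R : Set Space} {a m b α β : ℝ} (hα : α ≠ 0)
    (hinj : InjOn (fun t : ℝ => Complex.exp ((α * t + β : ℝ) * Complex.I)) (Icc a b))
    (hR : ∀ t ∈ Ioo a b, ∀ r ∈ R,
      r.1 ≠ (ellipseMap M W h₀ h₁ (Complex.exp ((α * t + β : ℝ) * Complex.I))).1) :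
    IsPassingArc ε R a m b
      fun t => ellipseMap M W h₀ h₁ (Complex.exp ((α * t + β : ℝ) * Complex.I)) where
  continuousOn := (continuous_ellipseMap.comp (by fun_prop)).continuousOn
  injOn := fun x hx y hy hxy => hinj hx hy ((ellipseMap_fst_inj hW).mp hxy)
  onSide := fun t ht r hr h => absurd h (hR t ht r hr)
  finite := by
    convert finite_empty
    ext t
    simp only [mem_ofPred_eq, mem_empty_iff_false, iff_false]
    rintro ⟨ht, r, hr, hrt⟩
    exact hR t ht r hr hrt
  hasDerivAt := by
    have h1 : HasDerivAt (fun t : ℝ => ((α * t + β : ℝ) : ℂ)) (α : ℂ) m :=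
      HasDerivAt.ofReal_comp (by simpa using ((hasDerivAt_id m).const_mul α).add_const β)
    have h2 := (((h1.mul_const Complex.I).cexp).const_mul W).const_add M
    refine ⟨_, ?_, h2⟩
    simp [hW, hα, Complex.exp_ne_zero]

end

namespace KnotDiagram

variable {D : KnotDiagram}

theorem proj_injOn_of_crossingTimes_eq_empty (h : D.crossingTimes = ∅) :
    InjOn D.proj (Ico 0 1) := by
  intro x hx y hy he
  by_contra hne
  have : y ∈ D.crossingTimes := mem_crossingTimes_of_eq hx hy hne he
  rw [h] at this
  exact this

/-- An initial straight segment becomes the diameter of an ellipse. With the segment fixed, the rest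
of the knot is moved to one half of the ellipse, then the segment to the other half. The fixed set
is each time part of the plane of the ellipse, so its slope is bounded even if the starting point is
a corner. Nothing crosses, so the choice of side is immaterial. -/
theorem isUnknot_of_crossingTimes_eq_empty (h : D.crossingTimes = ∅) : IsUnknot D.knot := by
  have hinj := proj_injOn_of_crossingTimes_eq_empty h
  obtain ⟨a, ha0, ha1, haff⟩ : ∃ a : ℝ, 0 < a ∧ a < 1 ∧ ∀ t ∈ Ioo 0 a, AffineAt D.toFun t := by
    have h0 : ∀ᶠ x in 𝓝 (0 : ℝ), x ∉ {t | t ∈ Ioo (0 : ℝ) 1 ∧ ¬ AffineAt D.toFun t} :=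
      D.polygonal.isClosed.isOpen_compl.mem_nhds fun h' => lt_irrefl _ h'.1.1
    obtain ⟨η, hη, hη'⟩ := Metric.eventually_nhds_iff.mp h0
    refine ⟨min η (1 / 2), lt_min hη (by norm_num), (min_le_right _ _).trans_lt (by norm_num),
      fun t ht => ?_⟩
    have h1 : t < η := ht.2.trans_le (min_le_left _ _)
    have h2 : t < 1 / 2 := ht.2.trans_le (min_le_right _ _)
    by_contra hcon
    refine hη' (y := t) ?_ ⟨⟨ht.1, by linarith⟩, hcon⟩
    rw [Real.dist_eq, sub_zero, abs_of_pos ht.1]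
    exact h1
  obtain ⟨V, hV⟩ := exists_eq_add_smul_of_affineAt ha0
    (D.continuousOn.mono (Icc_subset_Icc le_rfl ha1.le)) haff
  have hVa := hV a (right_mem_Icc.mpr ha0.le)
  rw [sub_zero] at hVa
  -- These constants give `E 1 = D.toFun 0` and `E (-1) = D.toFun a`, so that `E` maps the real
  -- interval `[-1, 1]` onto the segment.
  set W : ℂ := -((a / 2) • V.1) with hW
  set M : ℂ := (D.toFun 0).1 - W with hM
  set h₁ : ℝ := -(a / 2 * V.2) with hh₁
  set h₀ : ℝ := (D.toFun 0).2 - h₁ with hh₀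
  have hV0 : V.1 ≠ 0 := by
    intro hV0
    have : (D.toFun a).1 = (D.toFun 0).1 := by
      have := congrArg Prod.fst hVa
      simpa [hV0] using this
    exact ha0.ne' (hinj ⟨ha0.le, ha1⟩ ⟨le_rfl, one_pos⟩ this)
  have hW0 : W ≠ 0 := neg_ne_zero.mpr (smul_ne_zero (by linarith) hV0)
  set E := ellipseMap M W h₀ h₁ with hE
  have hDE : ∀ t ∈ Icc 0 a, D.toFun t = E ((1 - 2 * t / a : ℝ) : ℂ) := by
    intro t ht
    rw [hV t ht]
    refine Prod.ext ?_ ?_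
    · simp only [hE, ellipseMap, hM, hW, Prod.fst_add, Prod.smul_fst, sub_zero, Complex.real_smul]
      have ha : (a : ℂ) ≠ 0 := Complex.ofReal_ne_zero.mpr ha0.ne'
      push_cast
      field_simp
      ring
    · simp only [hE, ellipseMap, hh₀, hh₁, Prod.snd_add, Prod.smul_snd, sub_zero, smul_eq_mul,
        Complex.ofReal_re]
      field_simp
      ring
  have hE1 : D.toFun 0 = E 1 := by simpa using hDE 0 (left_mem_Icc.mpr ha0.le)
  have hEa : D.toFun a = E (-1) := by
    rw [hDE a (right_mem_Icc.mpr ha0.le)]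
    congr 1
    have : 1 - 2 * a / a = -1 := by field_simp; norm_num
    rw [this]
    simp
  set R : Set Space := D.toFun '' Icc 0 a with hR
  -- The angle `α * t + β` falls from `π` at `t = a` to 0 at `t = 1`, the upper half. Below, `γ * t`
  -- falls from 0 at `t = 0` to `-π` at `t = a`, the lower half.
  set α : ℝ := -(Real.pi / (1 - a)) with hα
  set β : ℝ := Real.pi / (1 - a) with hβ
  have h1a : 0 < 1 - a := by linarith
  have hα0 : α ≠ 0 := neg_ne_zero.mpr (div_pos Real.pi_pos h1a).ne'
  have hang : ∀ t, α * t + β = Real.pi * ((1 - t) / (1 - a)) := by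
    intro t
    rw [hα, hβ]
    field_simp
    ring
  have hangm : ∀ t ∈ Icc a 1, α * t + β ∈ Icc 0 Real.pi := by
    intro t ht
    rw [hang]
    have h1 : 0 ≤ (1 - t) / (1 - a) := div_nonneg (by linarith [ht.2]) h1a.le
    have h2 : (1 - t) / (1 - a) ≤ 1 := (div_le_one h1a).mpr (by linarith [ht.1])
    exact ⟨by positivity, by nlinarith [Real.pi_pos]⟩
  set e : ℝ → Space := fun t => E (Complex.exp ((α * t + β : ℝ) * Complex.I)) with he
  set γ : ℝ := -(Real.pi / a) with hγ
  set e' : ℝ → Space := fun t => E (Complex.exp ((γ * t + 0 : ℝ) * Complex.I)) with he'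
  have hsin : ∀ t ∈ Ioo 0 a, 0 < Real.sin (-(γ * t + 0)) := by
    intro t ht
    have : -(γ * t + 0) = Real.pi * (t / a) := by
      rw [hγ]
      field_simp
      ring
    rw [this]
    have h1 : 0 < t / a := div_pos ht.1 ha0
    have h2 : t / a < 1 := (div_lt_one ha0).mpr ht.2
    exact Real.sin_pos_of_pos_of_lt_pi (by positivity) (by nlinarith [Real.pi_pos])
  have hea : D.toFun a = e a := by
    have : α * a + β = Real.pi := by
      rw [hang, div_self h1a.ne', mul_one]
    simp only [he, this, Complex.exp_pi_mul_I, hEa]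
  have he1 : D.toFun 1 = e 1 := by
    have : α * 1 + β = 0 := by rw [hang]; simp
    simp only [he, this, ← D.closed, hE1]
    simp
  have he'0 : D.toFun 0 = e' 0 := by
    simp [he', hE1]
  have he'a : D.toFun a = e' a := by
    have : γ * a + 0 = -Real.pi := by
      rw [hγ]
      field_simp
      ring
    simp only [he', this, hEa]
    congr 1
    rw [Complex.ofReal_neg, neg_mul, Complex.exp_neg, Complex.exp_pi_mul_I]
    norm_num
  have hRE : R = E '' ((fun t : ℝ => ((1 - 2 * t / a : ℝ) : ℂ)) '' Icc 0 a) := by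
    rw [image_image]
    exact image_congr hDE
  have hinj1 : ∀ x ∈ Icc 0 1, ∀ y ∈ Ioo (0 : ℝ) 1, D.proj x = D.proj y → x = y := by
    intro x hx y hy hxy
    rcases hx.2.eq_or_lt with rfl | hx1
    · rw [proj_one] at hxy
      exact absurd (hinj ⟨le_rfl, one_pos⟩ ⟨hy.1.le, hy.2⟩ hxy) hy.1.ne
    · exact hinj ⟨hx.1, hx1⟩ ⟨hy.1.le, hy.2⟩ hxy
  have step1 : ArcIsotopic (-1) R a 1 D.toFun e := by
    obtain ⟨m, hm, hmD⟩ := exists_affineAt (D := D) ha0.le ha1 le_rfl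
    have hm01 : m ∈ Ioo (0 : ℝ) 1 := ⟨ha0.trans hm.1, hm.2⟩
    have hdis : ∀ t ∈ Ioo a 1, ∀ r ∈ R, r.1 ≠ (D.toFun t).1 := by
      rintro t ht _ ⟨x, hx, rfl⟩ hxt
      have := hinj1 x ⟨hx.1, hx.2.trans ha1.le⟩ t ⟨ha0.trans ht.1, ht.2⟩ hxt
      linarith [hx.2, ht.1]
    have hc : IsPassingArc (-1) R a m 1 D.toFun := by
      refine ⟨D.continuousOn.mono (Icc_subset_Icc ha0.le le_rfl), ?_,
        fun t ht r hr h' => absurd h' (hdis t ht r hr), ?_, ?_⟩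
      · intro x hx y hy hxy
        replace hxy : D.proj x = D.proj y := hxy
        rcases hy.2.eq_or_lt with rfl | hy1
        · by_contra hne
          exact hne (hinj1 1 (by simp) x ⟨ha0.trans_le hx.1, lt_of_le_of_ne hx.2 hne⟩ hxy.symm).symm
        · exact hinj1 x ⟨ha0.le.trans hx.1, hx.2⟩ y ⟨ha0.trans_le hy.1, hy1⟩ hxy
      · convert finite_empty
        ext t
        simp only [mem_ofPred_eq, mem_empty_iff_false, iff_false]
        rintro ⟨ht, r, hr, hrt⟩
        exact hdis t ht r hr hrt
      · obtain ⟨v, hv, hv'⟩ := hmD.exists_hasDerivAt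
        exact ⟨v.1, velocity_ne_zero hm01 hv', hv⟩
    refine arcIsotopic_of_isPassingArc (R := R)
      (isCompact_Icc.image_of_continuousOn (D.continuousOn.mono (Icc_subset_Icc le_rfl ha1.le)))
      hm.1 hm.2 hc (isPassingArc_ellipseMap hW0 hα0 ?_ ?_) hea he1 ?_ ?_
      ⟨0, left_mem_Icc.mpr ha0.le, D.closed⟩
    · intro x hx y hy hxy
      have h1 := congrArg Complex.re hxy
      simp only [Complex.exp_ofReal_mul_I_re] at h1
      have h2 := Real.injOn_cos (hangm x hx) (hangm y hy) h1
      exact mul_left_cancel₀ hα0 (add_right_cancel h2)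
    · rw [hRE]
      rintro t ht _ ⟨_, ⟨x, hx, rfl⟩, rfl⟩ hxt
      have h1 := congrArg Complex.im ((ellipseMap_fst_inj hW0).mp hxt)
      rw [Complex.exp_ofReal_mul_I_im, Complex.ofReal_im, hang] at h1
      have h2 : 0 < (1 - t) / (1 - a) := div_pos (by linarith [ht.2]) h1a
      have h3 : (1 - t) / (1 - a) < 1 := (div_lt_one h1a).mpr (by linarith [ht.1])
      exact (Real.sin_pos_of_pos_of_lt_pi (mul_pos Real.pi_pos h2)
        (by nlinarith [Real.pi_pos])).ne h1
    · rw [hRE, hEa]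
      exact boundedSlopeAt_ellipseMap hW0 _ _
    · rw [hRE, ← D.closed, hE1]
      exact boundedSlopeAt_ellipseMap hW0 _ _
  set R' : Set Space := e '' Icc a 1 with hR'
  have hR'E : R' = E '' ((fun t : ℝ => Complex.exp ((α * t + β : ℝ) * Complex.I)) '' Icc a 1) := by
    rw [image_image]
  have hec : Continuous e := continuous_ellipseMap.comp (by fun_prop)
  have step2 : ArcIsotopic (-1) R' 0 a D.toFun e' := by
    have hdis : ∀ t ∈ Ioo 0 a, ∀ r ∈ R', r.1 ≠ (D.toFun t).1 := by
      rw [hR'E]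
      rintro t ht _ ⟨_, ⟨x, hx, rfl⟩, rfl⟩ hxt
      rw [hDE t (Ioo_subset_Icc_self ht)] at hxt
      have h1 := congrArg norm ((ellipseMap_fst_inj hW0).mp hxt)
      rw [Complex.norm_exp_ofReal_mul_I, Complex.norm_real, Real.norm_eq_abs] at h1
      have h2 : 0 < t / a := div_pos ht.1 ha0
      have h3 : t / a < 1 := (div_lt_one ha0).mpr ht.2
      have h4 : |1 - 2 * t / a| < 1 := by
        rw [mul_div_assoc, abs_lt]
        constructor <;> linarith
      exact h4.ne h1.symm
    obtain ⟨m, hm, hmD⟩ := exists_affineAt (D := D) le_rfl ha0 ha1.le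
    have hc : IsPassingArc (-1) R' 0 m a D.toFun := by
      refine ⟨D.continuousOn.mono (Icc_subset_Icc le_rfl ha1.le), ?_,
        fun t ht r hr h' => absurd h' (hdis t ht r hr), ?_, ?_⟩
      · exact InjOn.mono (Icc_subset_Ico_right ha1) hinj
      · convert finite_empty
        ext t
        simp only [mem_ofPred_eq, mem_empty_iff_false, iff_false]
        rintro ⟨ht, r, hr, hrt⟩
        exact hdis t ht r hr hrt
      · obtain ⟨v, hv, hv'⟩ := hmD.exists_hasDerivAt
        exact ⟨v.1, velocity_ne_zero ⟨hm.1, hm.2.trans ha1⟩ hv', hv⟩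
    have hγ0 : γ ≠ 0 := neg_ne_zero.mpr (div_pos Real.pi_pos ha0).ne'
    refine arcIsotopic_of_isPassingArc (R := R') (isCompact_Icc.image hec) hm.1 hm.2 hc
      (isPassingArc_ellipseMap hW0 hγ0 ?_ ?_) he'0 he'a ?_ ?_
      ⟨a, left_mem_Icc.mpr ha1.le, hea.symm⟩
    · intro x hx y hy hxy
      have h1 := congrArg Complex.re hxy
      simp only [Complex.exp_ofReal_mul_I_re] at h1
      rw [← Real.cos_neg, ← Real.cos_neg (γ * y + 0)] at h1
      have hm : ∀ t ∈ Icc 0 a, -(γ * t + 0) ∈ Icc 0 Real.pi := by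
        intro t ht
        have : -(γ * t + 0) = Real.pi * (t / a) := by
          rw [hγ]
          field_simp
          ring
        rw [this]
        have h1 : 0 ≤ t / a := div_nonneg ht.1 ha0.le
        have h2 : t / a ≤ 1 := (div_le_one ha0).mpr ht.2
        exact ⟨by positivity, by nlinarith [Real.pi_pos]⟩
      have h2 := Real.injOn_cos (hm x hx) (hm y hy) h1
      exact mul_left_cancel₀ hγ0 (add_right_cancel (neg_injective h2))
    · rw [hR'E]
      rintro t ht _ ⟨_, ⟨x, hx, rfl⟩, rfl⟩ hxt
      have h1 := congrArg Complex.im ((ellipseMap_fst_inj hW0).mp hxt)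
      rw [Complex.exp_ofReal_mul_I_im, Complex.exp_ofReal_mul_I_im] at h1
      have h2 := Real.sin_nonneg_of_mem_Icc (hangm x hx)
      have h3 := hsin t ht
      rw [Real.sin_neg] at h3
      linarith
    · rw [hR'E, hE1]
      exact boundedSlopeAt_ellipseMap hW0 _ _
    · rw [hR'E, hEa]
      exact boundedSlopeAt_ellipseMap hW0 _ _
  have iso1 : AmbientIsotopic D.knot (R ∪ R') := by
    obtain ⟨H, hH, hce, hfix, -⟩ := step1
    refine ⟨H, hH, ?_⟩
    rw [knot, ← Icc_union_Icc_eq_Icc ha0.le ha1.le, image_union, image_union]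
    congr 1
    · exact (image_congr fun r hr => hfix 1 r hr).trans (image_id _)
    · rw [image_image]
      exact image_congr hce
  have iso2 : AmbientIsotopic (R ∪ R') (e' '' Icc 0 a ∪ R') := by
    obtain ⟨H, hH, hce, hfix, -⟩ := step2
    refine ⟨H, hH, ?_⟩
    rw [image_union]
    congr 1
    · rw [image_image]
      exact image_congr hce
    · exact (image_congr fun r hr => hfix 1 r hr).trans (image_id _)
  refine (iso1.trans iso2).isUnknot ?_
  convert isUnknot_ellipse (M := M) (h₀ := h₀) (h₁ := h₁) hW0 using 1
  ext x
  constructor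
  · rintro (⟨t, -, rfl⟩ | ⟨t, -, rfl⟩)
    · exact ⟨_, Complex.norm_exp_ofReal_mul_I _, rfl⟩
    · exact ⟨_, Complex.norm_exp_ofReal_mul_I _, rfl⟩
  · rintro ⟨ζ, hζ, rfl⟩
    have hζ' : Complex.exp (ζ.arg * Complex.I) = ζ := by
      have := Complex.norm_mul_exp_arg_mul_I ζ
      rwa [hζ, Complex.ofReal_one, one_mul] at this
    have hpi := Real.pi_pos
    rcases le_total 0 ζ.arg with h0 | h0
    · right
      refine ⟨1 - (1 - a) * (ζ.arg / Real.pi), ?_, ?_⟩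
      · have h1 : 0 ≤ ζ.arg / Real.pi := div_nonneg h0 hpi.le
        have h2 : ζ.arg / Real.pi ≤ 1 := (div_le_one hpi).mpr (Complex.arg_le_pi ζ)
        exact ⟨by nlinarith, by nlinarith⟩
      · have : α * (1 - (1 - a) * (ζ.arg / Real.pi)) + β = ζ.arg := by
          rw [hang]
          field_simp
          ring
        simp only [he, this, hζ', hE]
    · left
      refine ⟨a * (-ζ.arg / Real.pi), ?_, ?_⟩
      · have h1 : 0 ≤ -ζ.arg / Real.pi := div_nonneg (by linarith) hpi.le
        have h2 : -ζ.arg / Real.pi ≤ 1 :=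
          (div_le_one hpi).mpr (by linarith [Complex.neg_pi_lt_arg ζ])
        exact ⟨by positivity, by nlinarith⟩
      · have : γ * (a * (-ζ.arg / Real.pi)) + 0 = ζ.arg := by
          rw [hγ]
          field_simp
          ring
        simp only [he', this, hζ', hE]

end KnotDiagram

/-! ### The induction on the number of crossings -/

theorem theorem3p2 (D : KnotDiagram) (ε : ℤˣ)
    (hD : (ε = -1 ∧ D.IsAscending) ∨ (ε = 1 ∧ D.IsDescending)) :
    (∃ (N : ℕ) (S : ℕ → KnotDiagram), S 0 = D ∧
      ((S N).crossings = ∅ ∧ (S N).gaussCode = []) ∧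
      ∀ i < N, ∃ s t : ℝ,
        KnotDiagram.IsLoopDetour ε s t (S i) (S (i + 1)) ∧
        DeletesBlock ε ((S i).proj s) (S i).gaussCode (S (i + 1)).gaussCode ∧
        (S (i + 1)).crossingNumber < (S i).crossingNumber) ∧
    IsUnknot D.knot := by
  induction hn : D.crossingNumber using Nat.strong_induction_on generalizing D with
  | _ n ih =>
    rcases D.crossingTimes.eq_empty_or_nonempty with hempty | hne
    · refine ⟨⟨0, fun _ => D, rfl, ⟨?_, KnotDiagram.gaussCode_eq_nil hempty⟩,
        fun i hi => absurd hi (Nat.not_lt_zero i)⟩,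
        KnotDiagram.isUnknot_of_crossingTimes_eq_empty hempty⟩
      rw [KnotDiagram.crossings, hempty, image_empty]
    · obtain ⟨s, t, hs, ht, hst, heq, hfirst⟩ := D.exists_first_closing hne
      have hm := KnotDiagram.meetsOnly_of_first_closing hD ht.2.le hfirst
      obtain ⟨p, a, b, q, v, w, ρ, h⟩ := KnotDiagram.exists_isCrossingDisc hs ht hst heq
      set D' := D.replaceChord p q h.isReplaceable_outer with hD'
      have hDD' : (ε = -1 ∧ D'.IsAscending) ∨ (ε = 1 ∧ D'.IsDescending) :=
        hD.imp (fun h' => ⟨h'.1, h'.2.replaceChord _⟩) fun h' => ⟨h'.1, h'.2.replaceChord _⟩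
      obtain ⟨⟨N, S, hS0, hSN, hS⟩, hunknot⟩ :=
        ih D'.crossingNumber (hn ▸ h.crossingNumber_lt) D' hDD' rfl
      -- The sequence of the smaller diagram, with `D` put in front.
      refine ⟨⟨N + 1, fun i => Nat.casesOn i D S, rfl, hSN, fun i hi => ?_⟩,
        (h.ambientIsotopic hm).isUnknot hunknot⟩
      rcases i with _ | i
      · refine ⟨s, t, ?_⟩
        simp only [hS0]
        exact ⟨h.isLoopDetour hfirst hm, h.deletesBlock hfirst hm, h.crossingNumber_lt⟩
      · exact hS i (Nat.lt_of_succ_lt_succ hi)
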